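/- Let $K$ be a field and let $Q$ be a simply laced Dynkin quiver, i.e. a quiver whose underlying graph is a Dynkin diagram of type $A_n$ ($n\ge 1$), $D_n$ ($n\ge 4$), $E_6$, $E_7$ or $E_8$. Let $\mathcal S=D^b(\mathrm{mod}\text{-}KQ)$ be the bounded derived category of finitely generated right modules over the path algebra $KQ$, with shift functor $\Sigma$. A good metric on $\mathcal S$ is a decreasing sequence $\{B_n\}_{n\in\mathbb N}$ of full subcategories of $\mathcal S$ such that for every $n$: $0\in B_n$; $B_n$ is closed under extensions (if $X\to Y\to Z\to\Sigma X$ is a distinguished triangle with $X,Z\in B_n$, then $Y\in B_n$); and $\Sigma^{-1}B_{n+1}\cup B_{n+1}\cup\Sigma B_{n+1}\subseteq B_n$. It is additive if every $B_n$ is closed under direct summands. For good metrics write $\{C_n\}\le\{B_n\}$ if for every $n$ there is $m$ with $C_m\subseteq B_n$, and call two good metrics equivalent if each is $\le$ the other. The equivalence classes of good metrics on $\mathcal S$, ordered by $\le$, form a lattice $\mathbb M_{\mathcal S}$, in which $\{A_n\}\wedge\{C_n\}$ is the class of $\{A_n\cap C_n\}$ and $\{A_n\}\vee\{C_n\}$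 is the class of $\{\overline{A_n\cup C_n}\}$, where $\overline{\mathcal A}$ is the smallest full subcategory that contains $\mathcal A$ and $0$ and is closed under extensions. For $M\in\mathcal S$ let $\langle M\rangle$ be the triangulated subcategory of $\mathcal S$ generated by $M$, regarded also as the constant metric $\{\langle M\rangle\}_{n\in\mathbb N}$. Then for every additive good metric $\mathcal N=\{B_n\}_{n\in\mathbb N}$ on $\mathcal S$, $$\mathcal N=\bigvee_{M}\big(\mathcal N\wedge\langle M\rangle\big)\quad\text{in }\mathbb M_{\mathcal S},$$ where $M$ runs over the indecomposable finitely generated right $KQ$-modules, regarded as complexes concentrated in degree $0$; that is, the class of $\mathcal N$ is the least upper bound in $\mathbb M_{\mathcal S}$ of the classes of the metrics $\mathcal N\wedge\langle M\rangle$. -/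

import Mathlib

open CategoryTheory CategoryTheory.Limits CategoryTheory.Pretriangulated

universe w v u

/-! ### Good metrics on a triangulated category -/

section Metrics

open scoped ZeroObject

variable (C : Type u) [Category.{v} C] [HasZeroObject C] [HasShift C ℤ] [Preadditive C]
  [∀ n : ℤ, (shiftFunctor C n).Additive] [Pretriangulated C]

/-- A good metric: a decreasing chain of full subcategories (the balls), each of which contains
a zero object and is closed under extensions, with `Σ⁻¹ Bₙ₊₁ ∪ Bₙ₊₁ ∪ Σ Bₙ₊₁ ⊆ Bₙ`. (Closure
under isomorphisms follows from closure under extensions.) -/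
structure GoodMetric where
  /-- The balls of the metric. -/
  ball : ℕ → ObjectProperty C
  containsZero : ∀ n, (ball n).ContainsZero
  ext_closed : ∀ n, ∀ T ∈ distTriang C, ball n T.obj₁ → ball n T.obj₃ → ball n T.obj₂
  succ_le : ∀ n, ball (n + 1) ≤ ball n
  shift_neg : ∀ n X, ball (n + 1) X → ball n (X⟦(-1 : ℤ)⟧)
  shift_pos : ∀ n X, ball (n + 1) X → ball n (X⟦(1 : ℤ)⟧)

variable {C}

/-- The closure of a class of objects under zero objects and extensions. -/
inductive extClosure (P : ObjectProperty C) : C → Prop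
  | of (X : C) : P X → extClosure P X
  | zero (X : C) : IsZero X → extClosure P X
  | ext (T : Triangle C) : T ∈ distTriang C → extClosure P T.obj₁ → extClosure P T.obj₃ →
      extClosure P T.obj₂

/-- The triangulated subcategory generated by an object: the objects which lie in every full
triangulated subcategory (closed under isomorphisms) that contains the given object. -/
def triangGenerated (M : C) : ObjectProperty C := fun X =>
  ∀ P : ObjectProperty C, P.IsTriangulated → P.IsClosedUnderIsomorphisms → P M → P X

theorem triangGenerated_self (M : C) : triangGenerated M M := fun _ _ _ h => h

instance (M : C) : (triangGenerated M).IsClosedUnderIsomorphisms where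
  of_iso e h := fun P hP hP' hM => P.prop_of_iso e (h P hP hP' hM)

instance (M : C) : (triangGenerated M).IsTriangulated where
  exists_zero := ⟨0, isZero_zero C, fun P _ _ _ => P.prop_zero⟩
  isStableUnderShiftBy a := ⟨fun X h => by
    intro P hP hP' hM
    exact P.le_shift a X (h P hP hP' hM)⟩
  ext₂' T hT h₁ h₃ := (triangGenerated M).le_isoClosure _ (fun P hP hP' hM =>
    P.ext_of_isTriangulatedClosed₂ T hT (h₁ P hP hP' hM) (h₃ P hP hP' hM))

namespace GoodMetric

/-- A good metric is additive if its balls are closed under direct summands. -/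
def IsAdditive (N : GoodMetric C) : Prop :=
  ∀ (n : ℕ) (X Y : C), N.ball n (X ⊞ Y) → N.ball n X

/-- `A ≤ B` means that `A` is finer than `B`: every ball of `B` contains a ball of `A`. -/
instance : Preorder (GoodMetric C) where
  le A B := ∀ n, ∃ m, A.ball m ≤ B.ball n
  le_refl _ n := ⟨n, le_rfl⟩
  le_trans _ _ _ h₁ h₂ n := by
    obtain ⟨m, hm⟩ := h₂ n
    obtain ⟨k, hk⟩ := h₁ m
    exact ⟨k, hk.trans hm⟩

theorem ball_antitone (A : GoodMetric C) : Antitone A.ball := antitone_nat_of_succ_le A.succ_le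

theorem ball_of_isZero (A : GoodMetric C) (n : ℕ) {X : C} (hX : IsZero X) : A.ball n X := by
  obtain ⟨Z, hZ, h⟩ := (A.containsZero n).exists_zero
  refine A.ext_closed n (Triangle.mk (0 : Z ⟶ X) (0 : X ⟶ Z) (0 : Z ⟶ Z⟦(1 : ℤ)⟧))
    (isomorphic_distinguished _ (contractible_distinguished X) _
      (Triangle.isoMk _ _ (hZ.iso hX) (Iso.refl _) (hZ.iso (isZero_zero C))
        (hZ.eq_of_src _ _) (hX.eq_of_src _ _) (hZ.eq_of_src _ _))) h h

/-- The metric of the intersections of the balls. -/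
def inter (A B : GoodMetric C) : GoodMetric C where
  ball n := A.ball n ⊓ B.ball n
  containsZero n := ⟨0, isZero_zero C, A.ball_of_isZero n (isZero_zero C),
    B.ball_of_isZero n (isZero_zero C)⟩
  ext_closed n T hT h₁ h₃ :=
    ⟨A.ext_closed n T hT h₁.1 h₃.1, B.ext_closed n T hT h₁.2 h₃.2⟩
  succ_le n _ h := ⟨A.succ_le n _ h.1, B.succ_le n _ h.2⟩
  shift_neg n X h := ⟨A.shift_neg n X h.1, B.shift_neg n X h.2⟩
  shift_pos n X h := ⟨A.shift_pos n X h.1, B.shift_pos n X h.2⟩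

theorem extClosure_mono {P Q : ObjectProperty C} (h : P ≤ Q) (X : C) (hX : extClosure P X) :
    extClosure Q X := by
  induction hX with
  | of X hX => exact .of X (h X hX)
  | zero X hX => exact .zero X hX
  | ext T hT _ _ h₁ h₃ => exact .ext T hT h₁ h₃

theorem extClosure_shift {P Q : ObjectProperty C} (a : ℤ) (h : ∀ X, P X → Q (X⟦a⟧)) (X : C)
    (hX : extClosure P X) : extClosure Q (X⟦a⟧) := by
  induction hX with
  | of X hX => exact .of _ (h X hX)
  | zero X hX => exact .zero _ ((shiftFunctor C a).map_isZero hX)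
  | ext T hT _ _ h₁ h₃ =>
    exact .ext ((Triangle.shiftFunctor C a).obj T) (Triangle.shift_distinguished T hT a) h₁ h₃

theorem extClosure_le_ball (A : GoodMetric C) (n : ℕ) {P : ObjectProperty C} (h : P ≤ A.ball n)
    (X : C) (hX : extClosure P X) : A.ball n X := by
  induction hX with
  | of X hX => exact h X hX
  | zero X hX => exact A.ball_of_isZero n hX
  | ext T hT _ _ h₁ h₃ => exact A.ext_closed n T hT h₁ h₃

/-- The metric of the extension closures of the unions of the balls. -/
def union (A B : GoodMetric C) : GoodMetric C where
  ball n := extClosure (A.ball n ⊔ B.ball n)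
  containsZero _ := ⟨0, isZero_zero C, .zero _ (isZero_zero C)⟩
  ext_closed _ T hT h₁ h₃ := .ext T hT h₁ h₃
  succ_le n X h := extClosure_mono (sup_le_sup (A.succ_le n) (B.succ_le n)) X h
  shift_neg _ X h := extClosure_shift (-1)
    (fun Y hY => hY.imp (A.shift_neg _ Y) (B.shift_neg _ Y)) X h
  shift_pos _ X h := extClosure_shift 1
    (fun Y hY => hY.imp (A.shift_pos _ Y) (B.shift_pos _ Y)) X h

/-- The constant metric given by a triangulated subcategory. -/
def const (P : ObjectProperty C) [P.IsTriangulated] [P.IsClosedUnderIsomorphisms] :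
    GoodMetric C where
  ball _ := P
  containsZero _ := inferInstance
  ext_closed _ T hT h₁ h₃ := P.ext_of_isTriangulatedClosed₂ T hT h₁ h₃
  succ_le _ := le_rfl
  shift_neg _ X h := P.le_shift (-1) X h
  shift_pos _ X h := P.le_shift 1 X h

end GoodMetric

variable (C) in
/-- The lattice of good metrics: good metrics up to equivalence, two metrics being equivalent
if each is finer than the other, ordered by refinement. -/
abbrev MetricLattice : Type _ := Antisymmetrization (GoodMetric C) (· ≤ ·)

/-- The class of a good metric in the lattice of good metrics. -/
def GoodMetric.toLattice (A : GoodMetric C) : MetricLattice C :=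
  toAntisymmetrization (· ≤ ·) A

/-- Meets are given by intersections of balls, joins by extension closures of unions. -/
instance : Lattice (MetricLattice C) where
  inf := Quotient.map₂ GoodMetric.inter (by
    intro A A' hA B B' hB
    constructor <;> intro n
    · obtain ⟨i, hi⟩ := hA.1 n
      obtain ⟨j, hj⟩ := hB.1 n
      exact ⟨max i j, inf_le_inf ((A.ball_antitone (le_max_left i j)).trans hi)
        ((B.ball_antitone (le_max_right i j)).trans hj)⟩
    · obtain ⟨i, hi⟩ := hA.2 n
      obtain ⟨j, hj⟩ := hB.2 n
      exact ⟨max i j, inf_le_inf ((A'.ball_antitone (le_max_left i j)).trans hi)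
        ((B'.ball_antitone (le_max_right i j)).trans hj)⟩)
  sup := Quotient.map₂ GoodMetric.union (by
    intro A A' hA B B' hB
    constructor <;> intro n
    · obtain ⟨i, hi⟩ := hA.1 n
      obtain ⟨j, hj⟩ := hB.1 n
      exact ⟨max i j, GoodMetric.extClosure_mono (sup_le_sup
        ((A.ball_antitone (le_max_left i j)).trans hi)
        ((B.ball_antitone (le_max_right i j)).trans hj))⟩
    · obtain ⟨i, hi⟩ := hA.2 n
      obtain ⟨j, hj⟩ := hB.2 n
      exact ⟨max i j, GoodMetric.extClosure_mono (sup_le_sup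
        ((A'.ball_antitone (le_max_left i j)).trans hi)
        ((B'.ball_antitone (le_max_right i j)).trans hj))⟩)
  inf_le_left := by
    rintro ⟨A⟩ ⟨B⟩ n
    exact ⟨n, inf_le_left⟩
  inf_le_right := by
    rintro ⟨A⟩ ⟨B⟩ n
    exact ⟨n, inf_le_right⟩
  le_inf := by
    rintro ⟨A⟩ ⟨B⟩ ⟨D⟩ h₁ h₂ n
    obtain ⟨i, hi⟩ := h₁ n
    obtain ⟨j, hj⟩ := h₂ n
    exact ⟨max i j, le_inf ((A.ball_antitone (le_max_left i j)).trans hi)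
        ((A.ball_antitone (le_max_right i j)).trans hj)⟩
  le_sup_left := by
    rintro ⟨A⟩ ⟨B⟩ n
    exact ⟨n, fun X hX => .of X (Or.inl hX)⟩
  le_sup_right := by
    rintro ⟨A⟩ ⟨B⟩ n
    exact ⟨n, fun X hX => .of X (Or.inr hX)⟩
  sup_le := by
    rintro ⟨A⟩ ⟨B⟩ ⟨D⟩ h₁ h₂ n
    obtain ⟨i, hi⟩ := h₁ n
    obtain ⟨j, hj⟩ := h₂ n
    exact ⟨max i j, D.extClosure_le_ball n (sup_le
      ((A.ball_antitone (le_max_left i j)).trans hi)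
      ((B.ball_antitone (le_max_right i j)).trans hj))⟩

end Metrics

/-! ### Simply laced Dynkin quivers and their path algebras -/

/-- The Cartan matrices of the simply laced Dynkin diagrams `Aₙ` (`n ≥ 1`), `Dₙ` (`n ≥ 4`),
`E₆`, `E₇`, `E₈`. -/
inductive IsADECartan : ∀ {n : ℕ}, Matrix (Fin n) (Fin n) ℤ → Prop
  | A (n : ℕ) : 1 ≤ n → IsADECartan (CartanMatrix.A n)
  | D (n : ℕ) : 4 ≤ n → IsADECartan (CartanMatrix.D n)
  | E₆ : IsADECartan CartanMatrix.E₆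
  | E₇ : IsADECartan CartanMatrix.E₇
  | E₈ : IsADECartan CartanMatrix.E₈

/-- A simply laced Dynkin quiver: a quiver without loops whose underlying graph is a Dynkin
diagram of type `A`, `D` or `E`, that is, there is exactly one arrow (in one of the two
directions) between two vertices that are joined in the diagram, and none between distinct
vertices that are not. -/
class IsSimplyLacedDynkin (V : Type u) [Quiver.{v} V] : Prop where
  exists_diagram : ∃ (n : ℕ) (C : Matrix (Fin n) (Fin n) ℤ) (e : V ≃ Fin n), IsADECartan C ∧
    (∀ i : V, IsEmpty (i ⟶ i)) ∧
    ∀ i j : V, i ≠ j →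
      (C (e i) (e j) = -1 → Nonempty (Unique ((i ⟶ j) ⊕ (j ⟶ i)))) ∧
      (C (e i) (e j) = 0 → IsEmpty (i ⟶ j))

section PathAlgebra

variable (K : Type u) [Field K] (V : Type u) [Quiver.{u} V]

/-- The paths of a quiver, of all lengths and with all end points. -/
abbrev QuiverPaths : Type u := Σ a b : V, Quiver.Path a b

/-- The path algebra of a quiver: the vector space with the paths as a basis; the product of
two paths is their concatenation if the first ends where the second starts, and `0` if not. -/
def PathAlgebra : Type u := QuiverPaths V →₀ K

namespace PathAlgebra

noncomputable instance : AddCommGroup (PathAlgebra K V) :=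
  inferInstanceAs (AddCommGroup (QuiverPaths V →₀ K))

noncomputable instance : Module K (PathAlgebra K V) :=
  inferInstanceAs (Module K (QuiverPaths V →₀ K))

/-- The basis of the path algebra consisting of the paths. -/
noncomputable def basis : Module.Basis (QuiverPaths V) K (PathAlgebra K V) :=
  ⟨LinearEquiv.refl K (QuiverPaths V →₀ K)⟩

variable {V}

/-- The basis element of a path. -/
noncomputable def single {a b : V} (p : Quiver.Path a b) : PathAlgebra K V :=
  basis K V ⟨a, b, p⟩

open Classical in
/-- The product of two paths. -/
noncomputable def pathMul (x y : QuiverPaths V) : PathAlgebra K V :=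
  if h : x.2.1 = y.1 then single K (x.2.2.comp (y.2.2.cast h.symm rfl)) else 0

variable (V)

/-- The multiplication as a bilinear map. -/
noncomputable def mulLin : PathAlgebra K V →ₗ[K] PathAlgebra K V →ₗ[K] PathAlgebra K V :=
  (basis K V).constr K fun x => (basis K V).constr K fun y => pathMul K x y

variable {V}

theorem mulLin_single {a b c d : V} (p : Quiver.Path a b) (q : Quiver.Path c d) :
    mulLin K V (single K p) (single K q) = pathMul K ⟨a, b, p⟩ ⟨c, d, q⟩ := by
  simp [mulLin, single]

theorem pathMul_comp {a b c : V} (p : Quiver.Path a b) (q : Quiver.Path b c) :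
    pathMul K ⟨a, b, p⟩ ⟨b, c, q⟩ = single K (p.comp q) := by
  simp [pathMul]

theorem pathMul_of_ne {a b c d : V} (p : Quiver.Path a b) (q : Quiver.Path c d) (h : b ≠ c) :
    pathMul K ⟨a, b, p⟩ ⟨c, d, q⟩ = 0 := by
  unfold pathMul
  exact dif_neg h

variable {K} in
theorem linearMap_ext {W : Type*} [AddCommGroup W] [Module K W] {f g : PathAlgebra K V →ₗ[K] W}
    (h : ∀ (a b : V) (p : Quiver.Path a b), f (single K p) = g (single K p)) : f = g :=
  (basis K V).ext fun ⟨a, b, p⟩ => h a b p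

noncomputable instance : Mul (PathAlgebra K V) := ⟨fun x y => mulLin K V x y⟩

theorem mul_def (x y : PathAlgebra K V) : x * y = mulLin K V x y := rfl

theorem single_mul_single {a b c : V} (p : Quiver.Path a b) (q : Quiver.Path b c) :
    single K p * single K q = single K (p.comp q) := by
  rw [mul_def, mulLin_single, pathMul_comp]

theorem single_mul_single_of_ne {a b c d : V} (p : Quiver.Path a b) (q : Quiver.Path c d)
    (h : b ≠ c) : single K p * single K q = 0 := by
  rw [mul_def, mulLin_single, pathMul_of_ne K p q h]

theorem mul_assoc_aux (x y z : PathAlgebra K V) : x * y * z = x * (y * z) := by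
  refine LinearMap.congr_fun (f := (mulLin K V).flip z ∘ₗ (mulLin K V).flip y)
    (g := (mulLin K V).flip (y * z)) (linearMap_ext fun a b p => ?_) x
  change single K p * y * z = single K p * (y * z)
  refine LinearMap.congr_fun (f := (mulLin K V).flip z ∘ₗ mulLin K V (single K p))
    (g := mulLin K V (single K p) ∘ₗ (mulLin K V).flip z) (linearMap_ext fun c d q => ?_) y
  change single K p * single K q * z = single K p * (single K q * z)
  refine LinearMap.congr_fun (f := mulLin K V (single K p * single K q))
    (g := mulLin K V (single K p) ∘ₗ mulLin K V (single K q)) (linearMap_ext fun e f r => ?_) z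
  change single K p * single K q * single K r = single K p * (single K q * single K r)
  have zm : ∀ t : PathAlgebra K V, 0 * t = 0 := fun t => by simp [mul_def]
  have mz : ∀ t : PathAlgebra K V, t * 0 = 0 := fun t => by simp [mul_def]
  by_cases h₁ : b = c
  · subst h₁
    by_cases h₂ : d = e
    · subst h₂
      simp only [single_mul_single, Quiver.Path.comp_assoc]
    · rw [single_mul_single, single_mul_single_of_ne K _ _ h₂, single_mul_single_of_ne K _ _ h₂, mz]
  · rw [single_mul_single_of_ne K _ _ h₁, zm]
    by_cases h₂ : d = e
    · subst h₂
      rw [single_mul_single, single_mul_single_of_ne K _ _ h₁]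
    · rw [single_mul_single_of_ne K _ _ h₂, mz]

variable [Fintype V]

/-- The unit of the path algebra is the sum of the trivial paths. -/
noncomputable instance : One (PathAlgebra K V) :=
  ⟨∑ a : V, single K (Quiver.Path.nil : Quiver.Path a a)⟩

theorem one_def : (1 : PathAlgebra K V) = ∑ a : V, single K (Quiver.Path.nil : Quiver.Path a a) :=
  rfl

theorem one_mul_aux (x : PathAlgebra K V) : 1 * x = x := by
  refine LinearMap.congr_fun (f := mulLin K V 1) (g := LinearMap.id)
    (linearMap_ext fun a b p => ?_) x
  rw [one_def, map_sum, LinearMap.sum_apply, Finset.sum_eq_single a]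
  · rw [← mul_def, single_mul_single, Quiver.Path.nil_comp, LinearMap.id_apply]
  · intro c _ hc
    rw [← mul_def, single_mul_single_of_ne K _ _ hc]
  · simp

theorem mul_one_aux (x : PathAlgebra K V) : x * 1 = x := by
  refine LinearMap.congr_fun (f := (mulLin K V).flip 1) (g := LinearMap.id)
    (linearMap_ext fun a b p => ?_) x
  rw [one_def, map_sum, LinearMap.sum_apply, Finset.sum_eq_single b]
  · rw [LinearMap.flip_apply, ← mul_def, single_mul_single, Quiver.Path.comp_nil,
      LinearMap.id_apply]
  · intro c _ hc
    rw [LinearMap.flip_apply, ← mul_def, single_mul_single_of_ne K _ _ hc.symm]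
  · simp

noncomputable instance : Ring (PathAlgebra K V) where
  left_distrib x y z := by simp [mul_def]
  right_distrib x y z := by simp [mul_def]
  zero_mul x := by simp [mul_def]
  mul_zero x := by simp [mul_def]
  mul_assoc := mul_assoc_aux K
  one_mul := one_mul_aux K
  mul_one := mul_one_aux K
  zsmul := fun n x => n • x
  neg_add_cancel := neg_add_cancel
  sub_eq_add_neg := sub_eq_add_neg
  zsmul_zero' := SubNegMonoid.zsmul_zero'
  zsmul_succ' := SubNegMonoid.zsmul_succ'
  zsmul_neg' := SubNegMonoid.zsmul_neg'

noncomputable instance : Algebra K (PathAlgebra K V) :=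
  Algebra.ofModule (fun r x y => by simp [mul_def]) (fun r x y => by simp [mul_def])

end PathAlgebra

end PathAlgebra

/-! ### The path algebra of a simply laced Dynkin quiver is finite dimensional -/

section Finiteness

variable {V : Type u} [Quiver.{u} V]

/-- Each simply laced Dynkin diagram is a tree: its vertices can be given heights so that
adjacent vertices have different heights and each vertex has at most one lower neighbour. -/
theorem IsADECartan.exists_height {n : ℕ} {C : Matrix (Fin n) (Fin n) ℤ} (hC : IsADECartan C) :
    (∀ i j, i ≠ j → C i j = 0 ∨ C i j = -1) ∧ (∀ i j, C i j = C j i) ∧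
    ∃ f : Fin n → ℕ, (∀ i j, C i j = -1 → f i ≠ f j) ∧
      ∀ i j k, C i j = -1 → C i k = -1 → f j < f i → f k < f i → j = k := by
  cases hC with
  | A n hn =>
    refine ⟨CartanMatrix.isSimplyLaced_A n, fun i j => Matrix.IsSymm.apply (CartanMatrix.A_isSymm n) j i,
      fun i => i, ?_, ?_⟩
    · intro i j h
      simp only [CartanMatrix.A, Matrix.of_apply] at h
      grind
    · intro i j k h h'
      simp only [CartanMatrix.A, Matrix.of_apply] at h h'
      grind
  | D n hn =>
    refine ⟨CartanMatrix.isSimplyLaced_D n, fun i j => Matrix.IsSymm.apply (CartanMatrix.D_isSymm n) j i,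
      fun i => i, ?_, ?_⟩
    · intro i j h
      simp only [CartanMatrix.D, Matrix.of_apply] at h
      grind
    · intro i j k h h' hj hk
      simp only [CartanMatrix.D, Matrix.of_apply] at h h'
      dsimp only at hj hk
      ext
      split_ifs at h h' <;> omega
  | E₆ =>
    have h₁ : ∀ i j : Fin 6, Matrix.of.symm CartanMatrix.E₆ i j = -1 →
        (![2, 2, 1, 0, 1, 2] : Fin 6 → ℕ) i ≠ (![2, 2, 1, 0, 1, 2] : Fin 6 → ℕ) j := by decide
    have h₂ : ∀ i j k : Fin 6, Matrix.of.symm CartanMatrix.E₆ i j = -1 →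
        Matrix.of.symm CartanMatrix.E₆ i k = -1 →
        (![2, 2, 1, 0, 1, 2] : Fin 6 → ℕ) j < (![2, 2, 1, 0, 1, 2] : Fin 6 → ℕ) i →
        (![2, 2, 1, 0, 1, 2] : Fin 6 → ℕ) k < (![2, 2, 1, 0, 1, 2] : Fin 6 → ℕ) i → j = k := by decide
    exact ⟨CartanMatrix.isSimplyLaced_E₆,
      fun i j => Matrix.IsSymm.apply CartanMatrix.E₆_isSymm j i, _, h₁, h₂⟩
  | E₇ =>
    have h₁ : ∀ i j : Fin 7, Matrix.of.symm CartanMatrix.E₇ i j = -1 →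
        (![2, 2, 1, 0, 1, 2, 3] : Fin 7 → ℕ) i ≠ (![2, 2, 1, 0, 1, 2, 3] : Fin 7 → ℕ) j := by decide
    have h₂ : ∀ i j k : Fin 7, Matrix.of.symm CartanMatrix.E₇ i j = -1 →
        Matrix.of.symm CartanMatrix.E₇ i k = -1 →
        (![2, 2, 1, 0, 1, 2, 3] : Fin 7 → ℕ) j < (![2, 2, 1, 0, 1, 2, 3] : Fin 7 → ℕ) i →
        (![2, 2, 1, 0, 1, 2, 3] : Fin 7 → ℕ) k < (![2, 2, 1, 0, 1, 2, 3] : Fin 7 → ℕ) i → j = k := by decide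
    exact ⟨CartanMatrix.isSimplyLaced_E₇,
      fun i j => Matrix.IsSymm.apply CartanMatrix.E₇_isSymm j i, _, h₁, h₂⟩
  | E₈ =>
    have h₁ : ∀ i j : Fin 8, Matrix.of.symm CartanMatrix.E₈ i j = -1 →
        (![2, 2, 1, 0, 1, 2, 3, 4] : Fin 8 → ℕ) i ≠ (![2, 2, 1, 0, 1, 2, 3, 4] : Fin 8 → ℕ) j := by decide
    have h₂ : ∀ i j k : Fin 8, Matrix.of.symm CartanMatrix.E₈ i j = -1 →
        Matrix.of.symm CartanMatrix.E₈ i k = -1 →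
        (![2, 2, 1, 0, 1, 2, 3, 4] : Fin 8 → ℕ) j < (![2, 2, 1, 0, 1, 2, 3, 4] : Fin 8 → ℕ) i →
        (![2, 2, 1, 0, 1, 2, 3, 4] : Fin 8 → ℕ) k < (![2, 2, 1, 0, 1, 2, 3, 4] : Fin 8 → ℕ) i → j = k := by decide
    exact ⟨CartanMatrix.isSimplyLaced_E₈,
      fun i j => Matrix.IsSymm.apply CartanMatrix.E₈_isSymm j i, _, h₁, h₂⟩

/-- In a suitable height function, a path that goes up once keeps going up. -/
theorem IsSimplyLacedDynkin.exists_height [IsSimplyLacedDynkin V] :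
    ∃ f : V → ℕ, (∀ i j : V, (i ⟶ j) → f i ≠ f j) ∧
      ∀ i j k : V, (i ⟶ j) → (j ⟶ k) → f i < f j → f j < f k := by
  obtain ⟨n, C, e, hC, hl, h⟩ := IsSimplyLacedDynkin.exists_diagram (V := V)
  obtain ⟨h₀, hs, f, hf, hf'⟩ := hC.exists_height
  have key : ∀ i j : V, (i ⟶ j) → i ≠ j ∧ C (e i) (e j) = -1 := by
    intro i j a
    have hij : i ≠ j := by
      rintro rfl
      exact (hl i).false a
    refine ⟨hij, (h₀ _ _ (e.injective.ne hij)).resolve_left fun h0 => ?_⟩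
    exact ((h i j hij).2 h0).false a
  refine ⟨fun i => f (e i), fun i j a => hf _ _ (key i j a).2, fun i j k a b hlt => ?_⟩
  refine lt_of_le_of_ne (le_of_not_gt fun hgt => ?_) (hf _ _ (key j k b).2)
  have hik : i = k := e.injective (hf' (e j) (e i) (e k)
    ((hs _ _).trans (key i j a).2) (key j k b).2 hlt hgt)
  subst hik
  obtain ⟨u⟩ := (h i j (key i j a).1).1 (key i j a).2
  have : (Sum.inl a : (i ⟶ j) ⊕ (j ⟶ i)) = Sum.inr b := (u.eq_default _).trans
    (u.eq_default _).symm
  cases this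

/-- The paths in a simply laced Dynkin quiver have bounded length. -/
theorem IsSimplyLacedDynkin.exists_length_le [IsSimplyLacedDynkin V] [Finite V] :
    ∃ N : ℕ, ∀ (a b : V) (p : Quiver.Path a b), p.length ≤ N := by
  obtain ⟨f, hf, hf'⟩ := IsSimplyLacedDynkin.exists_height (V := V)
  obtain ⟨N, hN⟩ := (Set.finite_range f).bddAbove
  have hN' : ∀ a, f a ≤ N := fun a => hN ⟨a, rfl⟩
  have key : ∀ (a b : V) (p : Quiver.Path a b), p.length + f b ≤ f a ∨
      (p.length ≤ N + f b ∧ ∃ c : V, Nonempty (c ⟶ b) ∧ f c < f b) := by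
    intro a b p
    induction p with
    | nil => left; simp
    | @cons b c p x ih =>
      rw [Quiver.Path.length_cons]
      have ha := hN' a
      rcases lt_or_gt_of_ne (hf _ _ x) with hlt | hgt
      · right
        exact ⟨by rcases ih with ih | ih <;> omega, b, ⟨x⟩, hlt⟩
      · left
        rcases ih with ih | ⟨_, d, ⟨y⟩, hd⟩
        · omega
        · exact absurd (hf' _ _ _ y x hd) (by omega)
  refine ⟨N + N, fun a b p => ?_⟩
  have ha := hN' a
  have hb := hN' b
  rcases key a b p with h | h <;> omega

instance [IsSimplyLacedDynkin V] (i j : V) : Finite (i ⟶ j) := by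
  obtain ⟨n, C, e, hC, hl, h⟩ := IsSimplyLacedDynkin.exists_diagram (V := V)
  obtain ⟨h₀, -⟩ := hC.exists_height
  by_cases hij : i = j
  · subst hij
    have := hl i
    infer_instance
  · rcases h₀ _ _ (e.injective.ne hij) with h0 | h1
    · have := (h i j hij).2 h0
      infer_instance
    · obtain ⟨u⟩ := (h i j hij).1 h1
      exact Finite.of_injective (Sum.inl : (i ⟶ j) → (i ⟶ j) ⊕ (j ⟶ i)) Sum.inl_injective

theorem finite_paths_of_length [Finite V] [∀ i j : V, Finite (i ⟶ j)] (n : ℕ) :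
    Finite {x : QuiverPaths V // x.2.2.length = n} := by
  induction n with
  | zero =>
    refine Finite.of_surjective
      (fun a : V => (⟨⟨a, a, Quiver.Path.nil⟩, rfl⟩ : {x : QuiverPaths V // x.2.2.length = 0})) ?_
    rintro ⟨⟨a, b, p⟩, hp⟩
    cases p with
    | nil => exact ⟨a, rfl⟩
    | cons p x => simp at hp
  | succ n ih =>
    refine Finite.of_surjective
      (fun y : Σ (x : {x : QuiverPaths V // x.2.2.length = n}) (c : V), (x.1.2.1 ⟶ c) =>
        (⟨⟨y.1.1.1, y.2.1, y.1.1.2.2.cons y.2.2⟩, by simp [y.1.2]⟩ :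
          {x : QuiverPaths V // x.2.2.length = n + 1})) ?_
    rintro ⟨⟨a, b, p⟩, hp⟩
    cases p with
    | nil => simp at hp
    | @cons c _ p x => exact ⟨⟨⟨⟨a, c, p⟩, by simpa using hp⟩, b, x⟩, rfl⟩

instance [IsSimplyLacedDynkin V] [Finite V] : Finite (QuiverPaths V) := by
  obtain ⟨N, hN⟩ := IsSimplyLacedDynkin.exists_length_le (V := V)
  have := finite_paths_of_length (V := V)
  refine Finite.of_injective (fun x : QuiverPaths V =>
    (⟨⟨x.2.2.length, Nat.lt_succ_of_le (hN _ _ x.2.2)⟩, ⟨x, rfl⟩⟩ :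
      Σ n : Fin (N + 1), {x : QuiverPaths V // x.2.2.length = n})) ?_
  intro x y h
  have h1 : x.2.2.length = y.2.2.length := congrArg (fun z => (z.1 : ℕ)) h
  exact congrArg (fun z : Σ n : Fin (N + 1), {x : QuiverPaths V // x.2.2.length = n} => z.2.1) h

variable (K : Type u) [Field K]

instance [IsSimplyLacedDynkin V] [Finite V] : Module.Finite K (PathAlgebra K V) :=
  Module.Finite.of_basis (PathAlgebra.basis K V)

instance [IsSimplyLacedDynkin V] [Fintype V] : IsNoetherianRing (PathAlgebra K V)ᵐᵒᵖ :=
  IsNoetherianRing.of_finite K (PathAlgebra K V)ᵐᵒᵖ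

end Finiteness

/-! ### The bounded derived category -/

section DerivedCategory

variable (K : Type u) [Field K] (V : Type u) [Quiver.{u} V] [Fintype V]

/-- The category of finitely generated right modules over the path algebra. -/
abbrev ModPathAlgebra : Type (u + 1) := FGModuleCat.{u} (PathAlgebra K V)ᵐᵒᵖ

variable {A : Type v} [Category.{u} A] [Abelian A] [HasDerivedCategory.{w} A]

/-- An object of an abelian category as an object of its bounded derived category, concentrated
in degree zero. -/
noncomputable def stalkObj (M : A) : DerivedCategory.Bounded A :=
  ⟨(DerivedCategory.singleFunctor A 0).obj M, ⟨0, inferInstance⟩, ⟨0, inferInstance⟩⟩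

end DerivedCategory

/-! ### Representations of quivers -/

/-! Each `𝒩 ∧ ⟨M⟩` lies below `𝒩`. Conversely, let `D` be an upper bound and fix a ball `Dₙ`. For
each indecomposable `M` some `m(M)` satisfies `B_{m(M)} ∩ ⟨M⟩ ⊆ Dₙ`. Up to isomorphism there are
finitely many `M`, so one `m` serves them all. The module category is hereditary, so every object
`X` of `B_m` is a finite direct sum of shifts of indecomposable modules. Additivity puts the
summands in `B_m`; each lies in the corresponding `⟨M⟩`, hence in `Dₙ`, and closure under extensions
gives `X ∈ Dₙ`.

Two facts about `KQ` are needed, both over an arbitrary field. They are proved with representations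
and the two term complex `delta`, whose kernel is `Hom` and whose cokernel is `Ext¹`.

Heredity (`PathAlgebra.projective_of_injective`): `Ext¹` out of a free module vanishes, since the
equation `delta H = c` is solved recursively along paths. The vanishing passes to submodules, so
these are projective. Truncation triangles in the derived category then split
(`GoodMetric.IsAdditive.ball_le_of_stalkObj`).

Finite representation type (`ModPathAlgebra.exists_finite_indecomposable`): `dim Hom(X, X) - dim
Ext¹(X, X)` is the Tits form at the dimension vector of `X`, and this form is positive definite. A
brick with self-extensions would have `dim End ≤ dim Ext¹`, so bricks are rigid. A minimal rank
argument (`QuiverRep.IsIndec.isBrick`) then makes every indecomposable a brick. As `dim End ≤ dim X`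
for a brick, positive definiteness bounds the dimension vectors. For each vector there are finitely
many classes: over a finite field because there are finitely many matrices, over an infinite one
because rigid representations of equal dimension vector are isomorphic
(`QuiverRep.isIsomorphic_of_extVanishes`). -/

/-- A finite dimensional representation of a quiver. -/
structure QuiverRep (K : Type u) [Field K] (V : Type u) [Quiver.{v} V] where
  /-- The vector spaces at the vertices. -/
  space : V → Type w
  [addCommGroup : ∀ i, AddCommGroup (space i)]
  [module : ∀ i, Module K (space i)]
  [finite : ∀ i, FiniteDimensional K (space i)]
  /-- The linear maps along the arrows. -/
  map : ∀ {i j : V}, (i ⟶ j) → space i →ₗ[K] space j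

namespace QuiverRep

attribute [instance] addCommGroup module finite

variable {K : Type u} [Field K] {V : Type u} [Quiver.{v} V]

/-- Families of linear maps at the vertices. -/
abbrev Fam (X Y : QuiverRep.{w} K V) := ∀ i, X.space i →ₗ[K] Y.space i

/-- Families of linear maps along the arrows. -/
abbrev ArrowFam (X Y : QuiverRep.{w} K V) :=
  ∀ a : (Σ i j : V, i ⟶ j), X.space a.1 →ₗ[K] Y.space a.2.1

/-- The families which are morphisms of representations. -/
def IsHom {X Y : QuiverRep.{w} K V} (f : Fam X Y) : Prop :=
  ∀ ⦃i j : V⦄ (a : i ⟶ j) (x : X.space i), f j (X.map a x) = Y.map a (f i x)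

/-- The differential of the standard two term complex, whose kernel consists of the morphisms and
whose cokernel is the first extension group. -/
def delta (X Y : QuiverRep.{w} K V) : Fam X Y →ₗ[K] ArrowFam X Y where
  toFun f a := Y.map a.2.2 ∘ₗ f a.1 - f a.2.1 ∘ₗ X.map a.2.2
  map_add' f g := by ext a x; simp; abel
  map_smul' r f := by ext a x; simp [smul_sub]

/-- The vanishing of the first extension group. -/
def ExtVanishes (X Y : QuiverRep.{w} K V) : Prop := Function.Surjective (delta X Y)

theorem delta_apply {X Y : QuiverRep.{w} K V} (f : Fam X Y) {i j : V} (a : i ⟶ j)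
    (x : X.space i) : delta X Y f ⟨i, j, a⟩ x = Y.map a (f i x) - f j (X.map a x) := rfl

theorem delta_eq_zero_iff {X Y : QuiverRep.{w} K V} (f : Fam X Y) :
    delta X Y f = 0 ↔ IsHom f := by
  constructor
  · intro h i j a x
    have := LinearMap.congr_fun (congrFun h ⟨i, j, a⟩) x
    rw [delta_apply] at this
    exact (sub_eq_zero.1 this).symm
  · intro h
    funext ⟨i, j, a⟩
    ext x
    rw [delta_apply, h a x, sub_self]
    rfl

/-- Composition of families. -/
def comp {X Y Z : QuiverRep.{w} K V} (g : Fam Y Z) (f : Fam X Y) : Fam X Z := fun i => g i ∘ₗ f i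

@[simp] theorem comp_apply {X Y Z : QuiverRep.{w} K V} (g : Fam Y Z) (f : Fam X Y) (i : V)
    (x : X.space i) : comp g f i x = g i (f i x) := rfl

/-- The identity family. -/
def idFam (X : QuiverRep.{w} K V) : Fam X X := fun _ => LinearMap.id

@[simp] theorem idFam_apply (X : QuiverRep.{w} K V) (i : V) (x : X.space i) :
    X.idFam i x = x := rfl

theorem IsHom.comp {X Y Z : QuiverRep.{w} K V} {g : Fam Y Z} {f : Fam X Y} (hg : IsHom g)
    (hf : IsHom f) : IsHom (comp g f) := fun i j a x => by
  simp [hf a x, hg a]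

theorem isHom_id (X : QuiverRep.{w} K V) : IsHom X.idFam := fun _ _ _ _ => rfl

theorem IsHom.sub {X Y : QuiverRep.{w} K V} {f g : Fam X Y} (hf : IsHom f) (hg : IsHom g) :
    IsHom (f - g) := fun i j a x => by
  simp [hf a x, hg a x]

/-- The representation on the image of a morphism. -/
def image {X Y : QuiverRep.{w} K V} (f : Fam X Y) (hf : IsHom f) : QuiverRep.{w} K V where
  space i := LinearMap.range (f i)
  map {i j} a := (Y.map a).restrict (p := LinearMap.range (f i)) (q := LinearMap.range (f j)) (by
    rintro _ ⟨x, rfl⟩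
    exact ⟨X.map a x, hf a x⟩)

/-- The representation on the kernel of a morphism. -/
def ker {X Y : QuiverRep.{w} K V} (f : Fam X Y) (hf : IsHom f) : QuiverRep.{w} K V where
  space i := LinearMap.ker (f i)
  map {i j} a := (X.map a).restrict (p := LinearMap.ker (f i)) (q := LinearMap.ker (f j)) (by
    intro x hx
    rw [LinearMap.mem_ker] at hx ⊢
    rw [hf a x, hx, map_zero])

section

variable {X Y : QuiverRep.{w} K V} (f : Fam X Y) (hf : IsHom f)

/-- The inclusion of the image. -/
def imageι : Fam (image f hf) Y := fun i => (LinearMap.range (f i)).subtype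

/-- The projection onto the image. -/
def toImage : Fam X (image f hf) := fun i => (f i).rangeRestrict

/-- The inclusion of the kernel. -/
def kerι : Fam (ker f hf) X := fun i => (LinearMap.ker (f i)).subtype

theorem imageι_toImage (i : V) (x : X.space i) : imageι f hf i (toImage f hf i x) = f i x := rfl

theorem isHom_imageι : IsHom (imageι f hf) := fun _ _ _ _ => rfl

theorem isHom_kerι : IsHom (kerι f hf) := fun _ _ _ _ => rfl

theorem isHom_toImage : IsHom (toImage f hf) := fun _ _ a x => Subtype.ext (hf a x)

theorem imageι_injective (i : V) : Function.Injective (imageι f hf i) :=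
  Subtype.val_injective

theorem kerι_injective (i : V) : Function.Injective (kerι f hf i) := Subtype.val_injective

theorem toImage_surjective (i : V) : Function.Surjective (toImage f hf i) :=
  LinearMap.surjective_rangeRestrict _

theorem exists_kerι_eq {i : V} {x : X.space i} (hx : f i x = 0) :
    ∃ y, kerι f hf i y = x := ⟨⟨x, hx⟩, rfl⟩

theorem map_kerι (i : V) (y : (ker f hf).space i) : f i (kerι f hf i y) = 0 := y.2

end

/-- Extensions of a subrepresentation lift to extensions of the representation. -/
theorem ExtVanishes.of_injective {I M N : QuiverRep.{w} K V} (h : ExtVanishes M N) (f : Fam I M)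
    (hf : IsHom f) (hinj : ∀ i, Function.Injective (f i)) : ExtVanishes I N := by
  intro c
  choose l hl using fun i => (f i).exists_leftInverse_of_injective (LinearMap.ker_eq_bot.2 (hinj i))
  -- The retractions `l` need not commute with the arrows: every arrow family represents an
  -- extension class, so any linear extension of `c` will do. This is the right exactness of `Ext¹`.
  obtain ⟨k, hk⟩ := h fun a => c a ∘ₗ l a.1
  refine ⟨comp k f, ?_⟩
  funext ⟨i, j, a⟩
  ext x
  have h1 := LinearMap.congr_fun (congrFun hk ⟨i, j, a⟩) (f i x)
  have h2 : l i (f i x) = x := LinearMap.congr_fun (hl i) x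
  rw [delta_apply] at h1 ⊢
  simp only [comp_apply, hf a x]
  rw [h1]
  simp [h2]

/-- If the extensions of `I` by `N` vanish then every morphism to `N` from the kernel of
an epimorphism onto `I` extends. -/
theorem ExtVanishes.exists_extension {I N X U : QuiverRep.{w} K V} (h : ExtVanishes I N)
    (q : Fam X I) (hq : IsHom q) (hsurj : ∀ i, Function.Surjective (q i))
    (ι : Fam U X) (hι : IsHom ι) (hinj : ∀ i, Function.Injective (ι i))
    (hker : ∀ i x, q i x = 0 → ∃ y, ι i y = x) (hqι : ∀ i y, q i (ι i y) = 0)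
    (p : Fam U N) (hp : IsHom p) :
    ∃ r : Fam X N, IsHom r ∧ ∀ i y, r i (ι i y) = p i y := by
  choose l hl using fun i => (ι i).exists_leftInverse_of_injective (LinearMap.ker_eq_bot.2 (hinj i))
  choose s hs using fun i => (q i).exists_rightInverse_of_surjective
    (LinearMap.range_eq_top.2 (hsurj i))
  have hl' : ∀ i y, l i (ι i y) = y := fun i y => LinearMap.congr_fun (hl i) y
  have hs' : ∀ i y, q i (s i y) = y := fun i y => LinearMap.congr_fun (hs i) y
  -- `r₀` extends `p` only linearly. Its defect `delta r₀` vanishes on `U`, hence factors through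
  -- `q` and represents a class in `Ext¹(I, N)`; a family `k` killing that class corrects `r₀`
  -- without changing it on `U`.
  let r₀ : Fam X N := comp p l
  obtain ⟨k, hk⟩ := h fun a => delta X N r₀ a ∘ₗ s a.1
  have hzero : ∀ {i j : V} (a : i ⟶ j) (y : U.space i), delta X N r₀ ⟨i, j, a⟩ (ι i y) = 0 := by
    intro i j a y
    rw [delta_apply]
    simp only [r₀, comp_apply, hl', ← hι a y, hp a y, sub_self]
  have key : ∀ {i j : V} (a : i ⟶ j) (x : X.space i),
      delta X N r₀ ⟨i, j, a⟩ (s i (q i x)) = delta X N r₀ ⟨i, j, a⟩ x := by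
    intro i j a x
    obtain ⟨y, hy⟩ := hker i (s i (q i x) - x) (by rw [map_sub, hs', sub_self])
    rw [← sub_eq_zero, ← map_sub, ← hy, hzero]
  refine ⟨r₀ - comp k q, ?_, fun i y => ?_⟩
  · rw [← delta_eq_zero_iff]
    funext ⟨i, j, a⟩
    ext x
    have h1 := LinearMap.congr_fun (congrFun hk ⟨i, j, a⟩) (q i x)
    rw [LinearMap.comp_apply, key a x, delta_apply] at h1
    rw [map_sub, Pi.sub_apply, LinearMap.sub_apply, delta_apply (comp k q)]
    simp only [comp_apply, hq a x]
    rw [h1, sub_self]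
    rfl
  · simp [r₀, hl', hqι]

/-- A representation is indecomposable if it is nonzero and has no nontrivial idempotent
endomorphisms. -/
structure IsIndec (X : QuiverRep.{w} K V) : Prop where
  nontrivial : X.idFam ≠ 0
  idempotent : ∀ e : Fam X X, IsHom e → comp e e = e → e = 0 ∨ e = X.idFam

/-- A brick is a representation whose nonzero endomorphisms are injective. -/
def IsBrick (X : QuiverRep.{w} K V) : Prop :=
  ∀ f : Fam X X, IsHom f → f ≠ 0 → ∀ i, Function.Injective (f i)

theorem eq_id_of_injective {X : QuiverRep.{w} K V} {e : Fam X X} (he : comp e e = e)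
    (h : ∀ i, Function.Injective (e i)) : e = X.idFam := by
  funext i
  ext x
  exact h i (LinearMap.congr_fun (congrFun he i) x)

/-! ### Ranks, and indecomposable representations as bricks -/

section Fintype

variable [Fintype V]

/-- The total dimension of a representation. -/
noncomputable def dim (X : QuiverRep.{w} K V) : ℕ := ∑ i, Module.finrank K (X.space i)

/-- The total rank of a family of linear maps. -/
noncomputable def rank {X Y : QuiverRep.{w} K V} (f : Fam X Y) : ℕ :=
  ∑ i, Module.finrank K (LinearMap.range (f i))

theorem dim_image {X Y : QuiverRep.{w} K V} (f : Fam X Y) (hf : IsHom f) :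
    (image f hf).dim = rank f := rfl

theorem rank_le_dim {X Y : QuiverRep.{w} K V} (f : Fam X Y) : rank f ≤ X.dim :=
  Finset.sum_le_sum fun i _ => LinearMap.finrank_range_le (f i)

theorem rank_add_dim_ker {X Y : QuiverRep.{w} K V} (f : Fam X Y) (hf : IsHom f) :
    rank f + (ker f hf).dim = X.dim := by
  rw [rank, dim, dim, ← Finset.sum_add_distrib]
  exact Finset.sum_congr rfl fun i _ => (f i).finrank_range_add_finrank_ker

/-- The rank is at most the dimension at each vertex, so equality of the totals forces equality at
every vertex. -/
theorem injective_of_dim_le_rank {X Y : QuiverRep.{w} K V} (f : Fam X Y) (h : X.dim ≤ rank f)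
    (i : V) : Function.Injective (f i) := by
  have h1 : rank f = X.dim := le_antisymm (rank_le_dim f) h
  have h2 := (Finset.sum_eq_sum_iff_of_le
    (fun i _ => LinearMap.finrank_range_le (f i))).1 h1 i (Finset.mem_univ i)
  have h3 := (f i).finrank_range_add_finrank_ker
  rw [h2] at h3
  exact LinearMap.ker_eq_bot.1 (Submodule.finrank_eq_zero.1 (by omega))

theorem dim_le_rank_of_injective {X Y : QuiverRep.{w} K V} (f : Fam X Y)
    (h : ∀ i, Function.Injective (f i)) : X.dim = rank f :=
  Finset.sum_congr rfl fun i _ => (LinearMap.finrank_range_of_inj (h i)).symm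

theorem rank_comp_of_surjective {X Y Z : QuiverRep.{w} K V} (g : Fam Y Z) (f : Fam X Y)
    (hf : ∀ i, Function.Surjective (f i)) : rank (comp g f) = rank g := by
  refine Finset.sum_congr rfl fun i _ => ?_
  change Module.finrank K (LinearMap.range (g i ∘ₗ f i)) = _
  rw [LinearMap.range_comp_of_range_eq_top _ (LinearMap.range_eq_top.2 (hf i))]

theorem rank_comp_of_injective {X Y Z : QuiverRep.{w} K V} (g : Fam Y Z) (f : Fam X Y)
    (hg : ∀ i, Function.Injective (g i)) : rank (comp g f) = rank f := by
  refine Finset.sum_congr rfl fun i _ => ?_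
  change Module.finrank K (LinearMap.range (g i ∘ₗ f i)) = _
  rw [LinearMap.range_comp]
  exact (Submodule.equivMapOfInjective (g i) (hg i) _).finrank_eq.symm

/-- An endomorphism whose square has the same rank is invertible or zero, if the representation
is indecomposable. -/
theorem IsIndec.eq_zero_or_injective {X : QuiverRep.{w} K V} (hX : X.IsIndec) (f : Fam X X)
    (hf : IsHom f) (h : rank f ≤ rank (comp f f)) : f = 0 ∨ ∀ i, Function.Injective (f i) := by
  -- Fitting decomposition: `f` is injective on its image, so image and kernel are complementary,
  -- and the projection `e` onto the image is an idempotent endomorphism.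
  have hinj : ∀ i, Function.Injective ((comp f (imageι f hf)) i) := by
    refine injective_of_dim_le_rank _ ?_
    rw [dim_image]
    refine h.trans_eq ?_
    rw [← rank_comp_of_surjective (comp f (imageι f hf)) (toImage f hf) (toImage_surjective f hf)]
    rfl
  have hcompl : ∀ i, IsCompl (LinearMap.range (f i)) (LinearMap.ker (f i)) := by
    intro i
    have hdis : Disjoint (LinearMap.range (f i)) (LinearMap.ker (f i)) := by
      rw [Submodule.disjoint_def]
      intro x hx hx'
      have := hinj i (a₁ := ⟨x, hx⟩) (a₂ := 0) (by
        rw [map_zero]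
        exact hx')
      exact congrArg Subtype.val this
    exact (Submodule.isCompl_iff_disjoint _ _ (f i).finrank_range_add_finrank_ker.ge).2 hdis
  let e : Fam X X := fun i => Submodule.projection _ _ (hcompl i)
  have e1 : ∀ i x, e i (f i x) = f i x := fun i x =>
    Submodule.projection_apply_of_mem_left (hcompl i) ⟨x, rfl⟩
  have e2 : ∀ i x, f i x = 0 → e i x = 0 := fun i x hx =>
    Submodule.projection_apply_of_mem_right (hcompl i) hx
  have dec : ∀ i x, ∃ y z, f i z = 0 ∧ x = f i y + z := by
    intro i x
    have : x ∈ LinearMap.range (f i) ⊔ LinearMap.ker (f i) := by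
      rw [(hcompl i).sup_eq_top]; trivial
    obtain ⟨_, ⟨y, rfl⟩, z, hz, rfl⟩ := Submodule.mem_sup.1 this
    exact ⟨y, z, hz, rfl⟩
  have he : IsHom e := by
    intro i j a x
    obtain ⟨y, z, hz, rfl⟩ := dec i x
    have hz' : f j (X.map a z) = 0 := by rw [hf a z, hz, map_zero]
    simp only [map_add, e1, e2 _ _ hz, e2 _ _ hz', ← hf a y, map_zero]
  have hee : comp e e = e := by
    funext i
    ext x
    obtain ⟨y, z, hz, rfl⟩ := dec i x
    simp [e1, e2 _ _ hz]
  rcases hX.idempotent e he hee with h0 | h1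
  · left
    funext i
    ext x
    rw [← e1, h0]
    rfl
  · right
    intro i
    rw [injective_iff_map_eq_zero]
    intro x hx
    rw [← e2 i x hx, h1]
    rfl

theorem exists_rank_minimal {X Y : QuiverRep.{w} K V} (P : Fam X Y → Prop) (h : ∃ f, P f) :
    ∃ f, P f ∧ ∀ g, P g → rank f ≤ rank g := by
  obtain ⟨f, hf, hmin⟩ := WellFounded.has_min (measure (rank : Fam X Y → ℕ)).wf {f | P f} h
  exact ⟨f, hf, fun g hg => not_lt.1 (hmin g hg)⟩

theorem rank_eq_zero {X Y : QuiverRep.{w} K V} {f : Fam X Y} (h : rank f = 0) : f = 0 := by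
  funext i
  have := Finset.sum_eq_zero_iff.1 h i (Finset.mem_univ i)
  exact LinearMap.range_eq_bot.1 (Submodule.finrank_eq_zero.1 this)

/-- A representation with a nonzero subrepresentation has an indecomposable direct summand onto
which the subrepresentation projects nontrivially. -/
theorem exists_indec_summand {I U : QuiverRep.{w} K V} (g : Fam I U) (hg : g ≠ 0) :
    ∃ (P : QuiverRep.{w} K V) (s : Fam P U) (p : Fam U P), P.IsIndec ∧ IsHom s ∧ IsHom p ∧
      comp p s = P.idFam ∧ comp p g ≠ 0 ∧ P.dim ≤ U.dim := by
  -- The summand is the image of an idempotent of least rank among those that do not kill `g`.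
  obtain ⟨e, ⟨he, hee, heg⟩, hmin⟩ := exists_rank_minimal
    (fun e : Fam U U => IsHom e ∧ comp e e = e ∧ comp e g ≠ 0) ⟨U.idFam, isHom_id U, rfl, hg⟩
  have hee' : ∀ i x, e i (e i x) = e i x := fun i x => LinearMap.congr_fun (congrFun hee i) x
  have hps : comp (toImage e he) (imageι e he) = (image e he).idFam := by
    funext i
    ext x
    obtain ⟨y, rfl⟩ := toImage_surjective e he i x
    exact imageι_injective e he i (hee' i y)
  have hps' : ∀ i x, toImage e he i (imageι e he i x) = x :=
    fun i x => LinearMap.congr_fun (congrFun hps i) x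
  refine ⟨image e he, imageι e he, toImage e he, ⟨?_, ?_⟩, isHom_imageι e he,
    isHom_toImage e he, hps, ?_, by rw [dim_image]; exact rank_le_dim e⟩
  · intro h0
    refine heg ?_
    funext i
    ext x
    have := LinearMap.congr_fun (congrFun h0 i) (toImage e he i (g i x))
    exact congrArg (imageι e he i) this
  · intro u hu huu
    have huu' : ∀ i x, u i (u i x) = u i x := fun i x => LinearMap.congr_fun (congrFun huu i) x
    -- An idempotent `v` of the summand is also one of `U`, of the same rank; if it does not kill
    -- `g`, minimality makes it injective, hence the identity. For an arbitrary `u`, this applies to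
    -- `u` or to `1 - u`.
    have main : ∀ v : Fam (image e he) (image e he), IsHom v → comp v v = v →
        comp v (comp (toImage e he) g) ≠ 0 → v = (image e he).idFam := by
      intro v hv hvv hvg
      have hvv' : ∀ i x, v i (v i x) = v i x := fun i x => LinearMap.congr_fun (congrFun hvv i) x
      refine eq_id_of_injective hvv (injective_of_dim_le_rank _ ?_)
      rw [dim_image]
      refine (hmin (comp (imageι e he) (comp v (toImage e he)))
        ⟨(isHom_imageι e he).comp (hv.comp (isHom_toImage e he)), ?_, ?_⟩).trans ?_
      · funext i
        ext x
        simp only [comp_apply, hps', hvv']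
      · intro h0
        refine hvg ?_
        funext i
        ext x
        exact imageι_injective e he i (LinearMap.congr_fun (congrFun h0 i) x)
      · rw [rank_comp_of_injective _ _ (imageι_injective e he),
          rank_comp_of_surjective _ _ (toImage_surjective e he)]
    by_cases hug : comp u (comp (toImage e he) g) = 0
    · left
      have := main ((image e he).idFam - u) ((isHom_id _).sub hu) (by
        funext i
        ext x
        simp [huu']) (by
        intro h0
        refine heg ?_
        funext i
        ext x
        have h1 := LinearMap.congr_fun (congrFun h0 i) x
        have h2 := LinearMap.congr_fun (congrFun hug i) x
        have h3 : toImage e he i (g i x) = 0 := by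
          simpa [show u i (toImage e he i (g i x)) = 0 from h2] using h1
        exact congrArg (imageι e he i) h3)
      simpa using this
    · exact Or.inr (main u hu huu hug)
  · intro h0
    refine heg ?_
    funext i
    ext x
    exact congrArg (imageι e he i) (LinearMap.congr_fun (congrFun h0 i) x)

/-- If bricks have no self-extensions then all indecomposable representations are bricks. -/
theorem IsIndec.isBrick (hrig : ∀ P : QuiverRep.{w} K V, P.IsIndec → P.IsBrick → ExtVanishes P P)
    {X : QuiverRep.{w} K V} (hX : X.IsIndec) : X.IsBrick := by
  induction hn : X.dim using Nat.strong_induction_on generalizing X with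
  | _ n ih =>
  by_contra hb
  obtain ⟨θ, ⟨hθ, hθ0, hθi⟩, hmin⟩ := exists_rank_minimal
    (fun f : Fam X X => IsHom f ∧ f ≠ 0 ∧ ¬ ∀ i, Function.Injective (f i)) (by
      simp only [IsBrick, not_forall] at hb
      obtain ⟨f, hf, hf0, i, hi⟩ := hb
      exact ⟨f, hf, hf0, fun h => hi (h i)⟩)
  -- Injective endomorphisms have full rank, so `θ` has least rank among all nonzero endomorphisms.
  have hmin' : ∀ g : Fam X X, IsHom g → g ≠ 0 → rank θ ≤ rank g := by
    intro g hg hg0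
    by_cases hgi : ∀ i, Function.Injective (g i)
    · rw [← dim_le_rank_of_injective g hgi]
      exact rank_le_dim θ
    · exact hmin g ⟨hg, hg0, hgi⟩
  -- Otherwise `θ` and its square have the same rank and the Fitting argument applies. Hence the
  -- image of `θ` lies in its kernel, by way of `g`.
  have hsq : comp θ θ = 0 := by
    by_contra hne
    rcases hX.eq_zero_or_injective θ hθ (hmin' _ (hθ.comp hθ) hne) with h | h
    · exact hθ0 h
    · exact hθi h
  have hsq' : ∀ i x, θ i (θ i x) = 0 := fun i x => LinearMap.congr_fun (congrFun hsq i) x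
  let g : Fam (image θ hθ) (ker θ hθ) := fun i =>
    (LinearMap.range (θ i)).subtype.codRestrict (LinearMap.ker (θ i)) (by
      rintro ⟨_, y, rfl⟩
      exact hsq' i y)
  have hg : IsHom g := fun i j a x => rfl
  have hgι : ∀ i x, kerι θ hθ i (g i x) = imageι θ hθ i x := fun i x => rfl
  have hg0 : g ≠ 0 := by
    intro h0
    refine hθ0 ?_
    funext i
    ext x
    have := hgι i (toImage θ hθ i x)
    rw [imageι_toImage, h0] at this
    rw [← this]
    simp
  obtain ⟨P, s, p, hP, hs, hp, hps, hpg, hPdim⟩ := exists_indec_summand g hg0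
  have hps' : ∀ i x, p i (s i x) = x := fun i x => LinearMap.congr_fun (congrFun hps i) x
  have hlt : P.dim < X.dim := by
    have h1 := rank_add_dim_ker θ hθ
    have h2 : rank θ ≠ 0 := fun h => hθ0 (rank_eq_zero h)
    omega
  have hPr : ExtVanishes P P := hrig P hP (ih _ (hn ▸ hlt) hP rfl)
  have hsinj : ∀ i, Function.Injective (s i) := fun i => Function.LeftInverse.injective (hps' i)
  -- The composite `X → im θ → P → ker θ → X` is a nonzero endomorphism, so its rank is at least
  -- `rank θ = dim (im θ)`; this forces `im θ → P` to be injective.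
  have hpginj : ∀ i, Function.Injective (comp p g i) := by
    refine injective_of_dim_le_rank _ ?_
    rw [dim_image]
    refine (hmin' (comp (comp (kerι θ hθ) s) (comp (comp p g) (toImage θ hθ)))
      (((isHom_kerι θ hθ).comp hs).comp ((hp.comp hg).comp (isHom_toImage θ hθ))) ?_).trans ?_
    · intro h0
      refine hpg ?_
      funext i
      ext x
      obtain ⟨y, rfl⟩ := toImage_surjective θ hθ i x
      refine hsinj i (kerι_injective θ hθ i ?_)
      simpa using LinearMap.congr_fun (congrFun h0 i) y
    · rw [rank_comp_of_injective, rank_comp_of_surjective _ _ (toImage_surjective θ hθ)]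
      exact fun i => (kerι_injective θ hθ i).comp (hsinj i)
  -- Rigidity of `P` gives `Ext¹(im θ, P) = 0`, so the projection `ker θ → P` extends along `0 → ker
  -- θ → X → im θ → 0`. Thus `P` is a summand of `X` contained in `ker θ`: either `P = 0` or `θ =
  -- 0`, both impossible.
  obtain ⟨r, hr, hrι⟩ := (hPr.of_injective (comp p g) (hp.comp hg) hpginj).exists_extension
    (toImage θ hθ) (isHom_toImage θ hθ) (toImage_surjective θ hθ) (kerι θ hθ) (isHom_kerι θ hθ)
    (kerι_injective θ hθ)
    (fun i x hx => exists_kerι_eq θ hθ (congrArg (imageι θ hθ i) hx))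
    (fun i y => imageι_injective θ hθ i (map_kerι θ hθ i y)) p hp
  rcases hX.idempotent (comp (comp (kerι θ hθ) s) r) (((isHom_kerι θ hθ).comp hs).comp hr) (by
    funext i
    ext x
    simp [hrι, hps']) with h0 | h1
  · refine hP.nontrivial ?_
    funext i
    ext x
    have := LinearMap.congr_fun (congrFun h0 i) (kerι θ hθ i (s i x))
    simp only [comp_apply, hrι, hps'] at this
    exact hsinj i (kerι_injective θ hθ i (by simpa using this))
  · refine hθ0 ?_
    funext i
    ext x
    have := LinearMap.congr_fun (congrFun h1 i) x
    simp only [comp_apply, idFam_apply] at this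
    rw [← this, map_kerι]
    rfl

end Fintype

end QuiverRep

/-! ### Dimension counts for bricks -/

namespace QuiverRep

section Euler

variable {K : Type u} [Field K] {V : Type u} [Quiver.{v} V]

theorem exists_inverse {X Y : QuiverRep.{w} K V} {f : Fam X Y} (hf : IsHom f)
    (h : ∀ i, Function.Bijective (f i)) :
    ∃ g : Fam Y X, IsHom g ∧ (∀ i x, g i (f i x) = x) ∧ ∀ i y, f i (g i y) = y := by
  let e := fun i => LinearEquiv.ofBijective (f i) (h i)
  have h1 : ∀ i x, (e i).symm (f i x) = x := fun i x => (e i).symm_apply_apply x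
  have h2 : ∀ i y, f i ((e i).symm y) = y := fun i y => (e i).apply_symm_apply y
  refine ⟨fun i => (e i).symm, fun i j a y => ?_, h1, h2⟩
  refine (h j).1 ?_
  change f j ((e j).symm (Y.map a y)) = f j (X.map a ((e i).symm y))
  rw [h2, hf a, h2]

variable [Fintype V]

theorem finrank_fam (X Y : QuiverRep.{w} K V) :
    Module.finrank K (Fam X Y) = ∑ i, Module.finrank K (X.space i) * Module.finrank K (Y.space i) := by
  rw [Module.finrank_pi_fintype]
  exact Finset.sum_congr rfl fun i _ => Module.finrank_linearMap K K _ _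

/-- Evaluation at a nonzero vector is injective on the endomorphisms of a brick, whence `dim End ≤
dim X`. This cruder substitute for `End = K` is enough to bound dimension vectors and holds over
every field. -/
theorem IsBrick.finrank_fam_le {X : QuiverRep.{w} K V} (hX : X.IsBrick) (h0 : X.idFam ≠ 0)
    (h : ExtVanishes X X) :
    Module.finrank K (Fam X X) ≤ Module.finrank K (ArrowFam X X) + X.dim := by
  obtain ⟨i, x, hx⟩ : ∃ i, ∃ x : X.space i, x ≠ 0 := by
    by_contra hne
    push Not at hne
    refine h0 ?_
    funext i
    ext x
    exact hne i x
  let φ : LinearMap.ker (delta X X) →ₗ[K] X.space i :=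
    { toFun := fun f => f.1 i x
      map_add' := fun f g => by simp
      map_smul' := fun r f => by simp }
  have hφ : Function.Injective φ := by
    rw [injective_iff_map_eq_zero]
    rintro ⟨f, hf⟩ hfx
    by_contra hf0
    have hfi := hX f ((delta_eq_zero_iff f).1 hf) fun h => hf0 (Subtype.ext h)
    exact hx (hfi i (hfx.trans (map_zero (f i)).symm))
  have h1 := LinearMap.finrank_le_finrank_of_injective hφ
  have h2 := (delta X X).finrank_range_add_finrank_ker
  rw [LinearMap.range_eq_top.2 h, finrank_top] at h2
  have h3 : Module.finrank K (X.space i) ≤ X.dim :=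
    Finset.single_le_sum (f := fun i => Module.finrank K (X.space i))
      (fun _ _ => Nat.zero_le _) (Finset.mem_univ i)
  omega

variable [∀ i j : V, Fintype (i ⟶ j)]

theorem finrank_arrowFam (X Y : QuiverRep.{w} K V) :
    Module.finrank K (ArrowFam X Y) = ∑ i, ∑ j, Fintype.card (i ⟶ j) *
      (Module.finrank K (X.space i) * Module.finrank K (Y.space j)) := by
  rw [Module.finrank_pi_fintype, Fintype.sum_sigma]
  refine Finset.sum_congr rfl fun i _ => ?_
  rw [Fintype.sum_sigma]
  refine Finset.sum_congr rfl fun j _ => ?_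
  rw [← smul_eq_mul, ← Finset.card_univ, ← Finset.sum_const]
  exact Finset.sum_congr rfl fun a _ => Module.finrank_linearMap K K (X.space i) (Y.space j)

/-- The Euler form bounds the endomorphisms and self-extensions of a brick. -/
theorem IsBrick.extVanishes {X : QuiverRep.{w} K V} (hX : X.IsBrick)
    (h : Module.finrank K (ArrowFam X X) < Module.finrank K (Fam X X)) : ExtVanishes X X := by
  by_contra hne
  simp only [ExtVanishes, Function.Surjective, not_forall] at hne
  obtain ⟨c, hc⟩ := hne
  -- Endomorphisms act on the nonzero class of `c`. The action is injective because a nonzero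
  -- endomorphism `f` of a brick is invertible: `f c = delta k` would give `c = delta (f⁻¹ k)`. So
  -- `dim End ≤ dim Ext¹`, against `h`.
  let φ : LinearMap.ker (delta X X) →ₗ[K] ArrowFam X X ⧸ LinearMap.range (delta X X) :=
    (LinearMap.range (delta X X)).mkQ ∘ₗ
      { toFun := fun f a => f.1 a.2.1 ∘ₗ c a
        map_add' := fun f g => by ext a x; simp
        map_smul' := fun r f => by ext a x; simp }
  have hφ : Function.Injective φ := by
    rw [injective_iff_map_eq_zero]
    rintro ⟨f, hf⟩ h0
    by_contra hf0
    have hf' : IsHom f := (delta_eq_zero_iff f).1 hf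
    have hfi := hX f hf' fun h => hf0 (Subtype.ext h)
    obtain ⟨g, hg, hgf, -⟩ := exists_inverse hf' fun i =>
      ⟨hfi i, LinearMap.injective_iff_surjective.1 (hfi i)⟩
    obtain ⟨k, hk⟩ := (Submodule.Quotient.mk_eq_zero _).1 h0
    refine hc ⟨comp g k, ?_⟩
    funext ⟨i, j, a⟩
    ext x
    have h1 := LinearMap.congr_fun (congrFun hk ⟨i, j, a⟩) x
    rw [delta_apply] at h1
    have h2 := congrArg (g j) h1
    rw [map_sub, hg a] at h2
    rw [delta_apply, comp_apply, comp_apply, h2]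
    exact hgf j _
  have h1 := LinearMap.finrank_le_finrank_of_injective hφ
  have h2 := (delta X X).finrank_range_add_finrank_ker
  have h3 := (LinearMap.range (delta X X)).finrank_quotient_add_finrank
  omega

end Euler

end QuiverRep

/-! ### The Tits form of a simply laced Dynkin quiver -/

/-- Reduces a row of a Cartan matrix to the entries at the neighbours; the condition `k < n`
discards a neighbour beyond the end of the diagram. -/
theorem sum_fin_ite_eq (n k : ℕ) (g : ℕ → ℤ) :
    (∑ j : Fin n, if (j : ℕ) = k then g j else 0) = if k < n then g k else 0 := by
  rw [Fin.sum_univ_eq_sum_range (fun j => if j = k then g j else 0) n]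
  simp

/-- The Cartan matrices of type `A`, `D`, `E` map some positive vector to a positive vector. -/
theorem IsADECartan.exists_pos_vector {n : ℕ} {C : Matrix (Fin n) (Fin n) ℤ} (hC : IsADECartan C) :
    ∃ y : Fin n → ℤ, (∀ i, 0 < y i) ∧ ∀ i, 1 ≤ ∑ j, C i j * y j := by
  cases hC with
  | A n hn =>
    -- The coefficients of the sum of the positive roots in the simple roots. The quadratic has
    -- constant second difference `-2` and vanishes at `-1` and `n`, so every row gives `2`.
    refine ⟨fun i => (i + 1) * (n - i), fun i => ?_, fun i => ?_⟩
    · have := i.2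
      have : (0 : ℤ) < (n : ℤ) - (i : ℕ) := by omega
      positivity
    · let g : ℕ → ℤ := fun i => (i + 1) * (n - i)
      obtain ⟨i, hi⟩ := i
      have h2 : ∑ j : Fin n, CartanMatrix.A n ⟨i, hi⟩ j * g j =
          ∑ j : Fin n, (2 * (if (j : ℕ) = i then g j else 0) -
            (if (j : ℕ) = i + 1 then g j else 0) -
            if i = 0 then 0 else if (j : ℕ) = i - 1 then g j else 0) := by
        refine Finset.sum_congr rfl fun j _ => ?_
        simp only [CartanMatrix.A, Matrix.of_apply, Fin.ext_iff]
        split_ifs <;> omega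
      change 1 ≤ ∑ j : Fin n, CartanMatrix.A n ⟨i, hi⟩ j * g j
      rw [h2, Finset.sum_sub_distrib, Finset.sum_sub_distrib, ← Finset.mul_sum,
        sum_fin_ite_eq, sum_fin_ite_eq, if_pos hi]
      have h3 : (if i + 1 < n then g (i + 1) else 0) = g (i + 1) := by
        split_ifs with h
        · rfl
        · have : n = i + 1 := by omega
          simp [g, this]
      rw [h3]
      rcases i with _ | i
      · simp [g]
        linarith
      · have h4 : i < n := by omega
        simp only [Nat.add_eq_zero_iff, one_ne_zero, and_false, if_false, Nat.add_sub_cancel]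
        rw [sum_fin_ite_eq, if_pos h4]
        simp only [g]
        push_cast
        linarith
  | D n hn =>
    -- Twice the sum of the positive roots, to avoid a division. The two equal values at the forked
    -- ends add up to the value of the quadratic at `n - 2`, so every row gives `4`.
    let g : ℕ → ℤ := fun i => if i + 2 < n then 2 * (i + 1) * (2 * n - 2 - i) else n * (n - 1)
    refine ⟨fun i => g i, fun i => ?_, fun i => ?_⟩
    · have := i.2
      simp only [g]
      split_ifs
      · have : (0 : ℤ) < 2 * n - 2 - (i : ℕ) := by omega
        positivity
      · have : (0 : ℤ) < (n : ℤ) - 1 := by omega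
        positivity
    · obtain ⟨i, hi⟩ := i
      obtain ⟨m, rfl⟩ := Nat.exists_eq_add_of_le' hn
      by_cases h1 : i ≤ m
      · have h2 : ∑ j : Fin (m + 4), CartanMatrix.D (m + 4) ⟨i, hi⟩ j * g j =
          ∑ j : Fin (m + 4), (2 * (if (j : ℕ) = i then g j else 0) -
            (if (j : ℕ) = i + 1 then g j else 0) -
            if i = 0 then 0 else if (j : ℕ) = i - 1 then g j else 0) := by
          refine Finset.sum_congr rfl fun j _ => ?_
          simp only [CartanMatrix.D, Matrix.of_apply, Fin.ext_iff]
          split_ifs <;> omega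
        rw [h2, Finset.sum_sub_distrib, Finset.sum_sub_distrib, ← Finset.mul_sum,
          sum_fin_ite_eq, sum_fin_ite_eq, if_pos hi, if_pos (by omega)]
        rcases i with _ | i
        · simp [g]
          linarith
        · simp only [Nat.add_eq_zero_iff, one_ne_zero, and_false, if_false, Nat.add_sub_cancel]
          rw [sum_fin_ite_eq, if_pos (by omega)]
          simp only [g]
          rw [if_pos (by omega), if_pos (by omega), if_pos (by omega)]
          push_cast
          linarith
      · by_cases h3 : i = m + 1
        · have h2 : ∑ j : Fin (m + 4), CartanMatrix.D (m + 4) ⟨i, hi⟩ j * g j =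
            ∑ j : Fin (m + 4), (2 * (if (j : ℕ) = m + 1 then g j else 0) -
              (if (j : ℕ) = m + 2 then g j else 0) - (if (j : ℕ) = m + 3 then g j else 0) -
              if (j : ℕ) = m then g j else 0) := by
            refine Finset.sum_congr rfl fun j _ => ?_
            simp only [CartanMatrix.D, Matrix.of_apply, Fin.ext_iff]
            split_ifs <;> omega
          rw [h2, Finset.sum_sub_distrib, Finset.sum_sub_distrib, Finset.sum_sub_distrib,
            ← Finset.mul_sum, sum_fin_ite_eq, sum_fin_ite_eq, sum_fin_ite_eq, sum_fin_ite_eq]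
          simp [g]
          linarith
        · have h2 : ∑ j : Fin (m + 4), CartanMatrix.D (m + 4) ⟨i, hi⟩ j * g j =
            ∑ j : Fin (m + 4), (2 * (if (j : ℕ) = i then g j else 0) -
              (if (j : ℕ) = m + 1 then g j else 0)) := by
            refine Finset.sum_congr rfl fun j _ => ?_
            simp only [CartanMatrix.D, Matrix.of_apply, Fin.ext_iff]
            split_ifs <;> omega
          rw [h2, Finset.sum_sub_distrib, ← Finset.mul_sum, sum_fin_ite_eq, sum_fin_ite_eq,
            if_pos hi, if_pos (by omega)]
          simp only [g]
          rw [if_neg (by omega), if_pos (by omega)]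
          push_cast
          linarith
  -- In the exceptional types the vector is again the sum of the positive roots, and every row gives
  -- `2`.
  | E₆ => exact ⟨![16, 22, 30, 42, 30, 16], by decide, by decide⟩
  | E₇ => exact ⟨![34, 49, 66, 96, 75, 52, 27], by decide, by decide⟩
  | E₈ => exact ⟨![92, 136, 182, 270, 220, 168, 114, 58], by decide, by decide⟩

/-- A symmetric matrix with nonpositive off-diagonal entries which maps a positive vector to
a positive vector is positive definite. -/
theorem sum_div_le_quadraticForm {ι : Type*} [Fintype ι] (C : ι → ι → ℚ) (y x : ι → ℚ)
    (hs : ∀ i j, C i j = C j i) (hoff : ∀ i j, i ≠ j → C i j ≤ 0) (hy : ∀ i, 0 < y i)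
    (hCy : ∀ i, 1 ≤ ∑ j, C i j * y j) :
    ∑ i, x i ^ 2 / y i ≤ ∑ i, ∑ j, C i j * x i * x j := by
  -- The bracket is `(y j * x i - y i * x j) ^ 2 / (y i * y j)`, which vanishes on the diagonal.
  -- Expanding the sum leaves twice the form minus twice `∑ (x i ^ 2 / y i) * (C y) i`.
  have h1 : 0 ≤ ∑ i, ∑ j, -C i j * (y j * (x i ^ 2 / y i) + y i * (x j ^ 2 / y j) -
      2 * (x i * x j)) := by
    refine Finset.sum_nonneg fun i _ => Finset.sum_nonneg fun j _ => ?_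
    by_cases hij : i = j
    · subst hij
      have := (hy i).ne'
      apply le_of_eq
      field_simp
      ring
    · refine mul_nonneg (neg_nonneg.2 (hoff i j hij)) ?_
      have hi := hy i
      have hj := hy j
      have : y j * (x i ^ 2 / y i) + y i * (x j ^ 2 / y j) - 2 * (x i * x j) =
          (y j * x i - y i * x j) ^ 2 / (y i * y j) := by
        field_simp
        ring
      rw [this]
      positivity
  have h2 : ∑ i, ∑ j, -C i j * (y j * (x i ^ 2 / y i) + y i * (x j ^ 2 / y j) -
      2 * (x i * x j)) = 2 * ∑ i, ∑ j, C i j * x i * x j -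
        2 * ∑ i, (x i ^ 2 / y i) * ∑ j, C i j * y j := by
    have h3 : ∑ i, ∑ j, C i j * (y i * (x j ^ 2 / y j)) =
        ∑ i, ∑ j, C i j * (y j * (x i ^ 2 / y i)) := by
      rw [Finset.sum_comm]
      simp_rw [hs]
    have h4 : ∑ i, (x i ^ 2 / y i) * ∑ j, C i j * y j =
        ∑ i, ∑ j, C i j * (y j * (x i ^ 2 / y i)) := by
      refine Finset.sum_congr rfl fun i _ => ?_
      rw [Finset.mul_sum]
      exact Finset.sum_congr rfl fun j _ => by ring
    have h5 : ∀ i j, -C i j * (y j * (x i ^ 2 / y i) + y i * (x j ^ 2 / y j) - 2 * (x i * x j)) =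
        2 * (C i j * x i * x j) - C i j * (y j * (x i ^ 2 / y i)) -
          C i j * (y i * (x j ^ 2 / y j)) := fun i j => by ring
    simp_rw [h5, Finset.sum_sub_distrib, ← Finset.mul_sum]
    rw [h3, h4]
    ring
  have h6 : ∑ i, x i ^ 2 / y i ≤ ∑ i, (x i ^ 2 / y i) * ∑ j, C i j * y j := by
    refine Finset.sum_le_sum fun i _ => le_mul_of_one_le_right ?_ (hCy i)
    exact div_nonneg (sq_nonneg _) (hy i).le
  rw [h2] at h1
  linarith

theorem IsADECartan.diag {n : ℕ} {C : Matrix (Fin n) (Fin n) ℤ} (hC : IsADECartan C) (i : Fin n) :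
    C i i = 2 := by
  cases hC with
  | A n hn => exact congrFun (CartanMatrix.A_diag n) i
  | D n hn => exact CartanMatrix.D_diag n i
  | E₆ => exact CartanMatrix.E₆_diag i
  | E₇ => exact CartanMatrix.E₇_diag i
  | E₈ => exact CartanMatrix.E₈_diag i

/-- The Tits form of a simply laced Dynkin quiver is positive definite. -/
theorem IsSimplyLacedDynkin.exists_sum_sq_le {V : Type u} [Fintype V] [Quiver.{v} V]
    [IsSimplyLacedDynkin V] [∀ i j : V, Fintype (i ⟶ j)] :
    ∃ Y : ℕ, ∀ d : V → ℤ, ∑ i, d i ^ 2 ≤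
      Y * (∑ i, d i * d i - ∑ i, ∑ j, Fintype.card (i ⟶ j) * (d i * d j)) := by
  obtain ⟨n, C, e, hC, hl, h⟩ := IsSimplyLacedDynkin.exists_diagram (V := V)
  obtain ⟨h₀, hs, -⟩ := hC.exists_height
  obtain ⟨y, hy, hCy⟩ := hC.exists_pos_vector
  classical
  have hcard : ∀ i j : V, (C (e i) (e j) : ℤ) = (if i = j then 2 else 0) -
      (Fintype.card (i ⟶ j) + Fintype.card (j ⟶ i)) := by
    intro i j
    by_cases hij : i = j
    · subst hij
      have := hl i
      simp [hC.diag]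
    · rw [if_neg hij]
      rcases h₀ _ _ (e.injective.ne hij) with h0 | h1
      · have := (h i j hij).2 h0
        have := (h j i (Ne.symm hij)).2 ((hs _ _).trans h0)
        simp [h0]
      · obtain ⟨u⟩ := (h i j hij).1 h1
        have := Fintype.card_unique (α := (i ⟶ j) ⊕ (j ⟶ i))
        rw [Fintype.card_sum] at this
        rw [h1]
        omega
  have hform : ∀ d : V → ℤ, ∑ i, ∑ j, C (e i) (e j) * d i * d j =
      2 * (∑ i, d i * d i - ∑ i, ∑ j, Fintype.card (i ⟶ j) * (d i * d j)) := by
    intro d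
    have h1 : ∑ i, ∑ j, (Fintype.card (j ⟶ i) : ℤ) * (d i * d j) =
        ∑ i, ∑ j, (Fintype.card (i ⟶ j) : ℤ) * (d i * d j) := by
      rw [Finset.sum_comm]
      exact Finset.sum_congr rfl fun i _ => Finset.sum_congr rfl fun j _ => by ring
    have h2 : ∀ i j, C (e i) (e j) * d i * d j = (if i = j then 2 * (d i * d j) else 0) -
        (Fintype.card (i ⟶ j) * (d i * d j) + Fintype.card (j ⟶ i) * (d i * d j)) := by
      intro i j
      rw [hcard]
      split_ifs <;> ring
    simp_rw [h2, Finset.sum_sub_distrib, Finset.sum_add_distrib]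
    rw [h1]
    simp only [Finset.sum_ite_eq, Finset.mem_univ, if_true, ← Finset.mul_sum]
    ring
  -- The factor `2` relates the Cartan form to the Tits form; `∑ y` bounds each `y i` and so clears
  -- the denominators in `∑ d i ^ 2 / y i`.
  refine ⟨2 * (∑ i, y i).toNat, fun d => ?_⟩
  have hY : ∀ i, y i ≤ ∑ i, y i := fun i =>
    Finset.single_le_sum (f := y) (fun i _ => (hy i).le) (Finset.mem_univ i)
  have hY0 : 0 ≤ ∑ i, y i := Finset.sum_nonneg fun i _ => (hy i).le
  have key := sum_div_le_quadraticForm (fun i j : V => (C (e i) (e j) : ℚ)) (fun i => (y (e i) : ℚ))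
    (fun i => (d i : ℚ)) (fun i j => by rw [hs]) (fun i j hij => by
      rcases h₀ _ _ (e.injective.ne hij) with h0 | h1
      · simp [h0]
      · simp [h1]) (fun i => by exact_mod_cast hy (e i)) (fun i => by
      have := hCy (e i)
      rw [← e.sum_comp] at this
      exact_mod_cast this)
  have h1 : (∑ i, (d i : ℚ) ^ 2) ≤ (∑ i, y i : ℤ) * ∑ i, (d i : ℚ) ^ 2 / (y (e i) : ℚ) := by
    rw [Finset.mul_sum]
    refine Finset.sum_le_sum fun i _ => ?_
    have h2 : (0 : ℚ) < y (e i) := by exact_mod_cast hy (e i)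
    have h3 : (y (e i) : ℚ) ≤ (∑ i, y i : ℤ) := by exact_mod_cast hY (e i)
    rw [← mul_div_assoc, le_div_iff₀ h2, mul_comm]
    exact mul_le_mul_of_nonneg_right h3 (sq_nonneg _)
  have h4 : (0 : ℚ) ≤ (∑ i, y i : ℤ) := by exact_mod_cast hY0
  have h5 := h1.trans (mul_le_mul_of_nonneg_left key h4)
  have h6 : ∑ i, d i ^ 2 ≤ (∑ i, y i) * ∑ i, ∑ j, C (e i) (e j) * d i * d j := by
    exact_mod_cast h5
  rw [hform] at h6
  push_cast
  rw [Int.toNat_of_nonneg hY0]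
  linarith

/-- Bounded values of the Tits form bound the vector. -/
theorem exists_bound_of_sum_sq_le {V : Type u} [Fintype V] (Y : ℕ) :
    ∃ B : ℕ, ∀ d : V → ℕ, (∑ i, (d i : ℤ) ^ 2 ≤ Y * ∑ i, (d i : ℤ)) → ∀ i, d i ≤ B := by
  -- The sum of the terms `d i * (d i - Y)` is at most `0` and each is at least `-Y ^ 2`, so no
  -- single term can exceed `card V * Y ^ 2`.
  refine ⟨Y + Fintype.card V * Y ^ 2, fun d hd k => ?_⟩
  have h1 : ∑ i, (d i : ℤ) * (d i - Y) ≤ 0 := by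
    have : ∑ i, (d i : ℤ) * (d i - Y) = ∑ i, (d i : ℤ) ^ 2 - Y * ∑ i, (d i : ℤ) := by
      rw [Finset.mul_sum, ← Finset.sum_sub_distrib]
      exact Finset.sum_congr rfl fun i _ => by ring
    linarith
  have h2 : ∀ i, 0 ≤ (d i : ℤ) * (d i - Y) + Y ^ 2 := fun i => by
    nlinarith [sq_nonneg ((d i : ℤ) - Y), sq_nonneg (d i : ℤ)]
  have h3 := Finset.single_le_sum (f := fun i => (d i : ℤ) * (d i - Y) + Y ^ 2)
    (fun i _ => h2 i) (Finset.mem_univ k)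
  rw [Finset.sum_add_distrib, Finset.sum_const, Finset.card_univ, nsmul_eq_mul] at h3
  by_contra hlt
  push Not at hlt
  have h4 : (Y : ℤ) + Fintype.card V * Y ^ 2 + 1 ≤ d k := by exact_mod_cast hlt
  have h5 : (0 : ℤ) ≤ Fintype.card V * Y ^ 2 := by positivity
  have h6 : (0 : ℤ) ≤ (Y : ℤ) ^ 2 := by positivity
  have h7 : (1 : ℤ) ≤ d k := by
    have : (0 : ℤ) ≤ Y := by positivity
    linarith
  nlinarith

/-! ### Linear systems and determinants depending on a parameter -/

section PolynomialFamilies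

open Polynomial

variable {K : Type*} [Field K] {E : Type*} [AddCommGroup E] [Module K E] [FiniteDimensional K E]

/-- The system `w - t T w = x` has, up to a scalar, a solution depending polynomially on `t`. -/
theorem exists_polynomial_solution (T : E →ₗ[K] E) (x : E) :
    ∃ (n : ℕ) (g : Fin n → K[X]) (b : Fin n → E),
      (∀ t : K, ∃ c : K, (∑ i, (g i).eval t • b i) =
        t • T (∑ i, (g i).eval t • b i) + c • x) ∧
      ∑ i, (g i).eval 0 • b i = x := by
  let b := Module.finBasis K E
  let M := LinearMap.toMatrix b b T
  let N : Matrix _ _ K[X] := 1 - (X : K[X]) • M.map C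
  -- Cramer's rule without division: applying `N` to `g` gives `det N` times `x`, so the scalar `c`
  -- is `det N` at `t`. At `t = 0` the adjugate is the identity.
  let g := N.adjugate.mulVec fun i => C (b.repr x i)
  have hN : ∀ t : K, N.map (evalRingHom t) = 1 - t • M := by
    intro t
    ext i j
    by_cases h : i = j
    · subst h
      simp [N]
      ring
    · simp [N, Matrix.one_apply_ne h]
      ring
  have hg : N.mulVec g = N.det • fun i => C (b.repr x i) := by
    rw [Matrix.mulVec_mulVec, Matrix.mul_adjugate, Matrix.smul_mulVec, Matrix.one_mulVec]
  have hw : ∀ t : K, b.repr (∑ i, (g i).eval t • b i) = fun i => (g i).eval t := by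
    intro t
    exact b.repr_sum_self fun i => (g i).eval t
  refine ⟨_, g, b, fun t => ⟨N.det.eval t, ?_⟩, ?_⟩
  · refine b.repr.injective (DFunLike.coe_injective ?_)
    have h1 : (1 - t • M).mulVec (fun i => (g i).eval t) =
        N.det.eval t • fun i => b.repr x i := by
      rw [← hN]
      have h2 := congrArg (fun v : Fin _ → K[X] => fun i => evalRingHom t (v i)) hg
      funext i
      have h3 := congrFun h2 i
      simp only [RingHom.map_mulVec] at h3
      simpa [Function.comp_def] using h3
    rw [Matrix.sub_mulVec, Matrix.one_mulVec, Matrix.smul_mulVec, ← hw,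
      LinearMap.toMatrix_mulVec_repr] at h1
    rw [sub_eq_iff_eq_add, add_comm] at h1
    rw [h1]
    simp
  · refine b.repr.injective (DFunLike.coe_injective ?_)
    rw [hw]
    funext i
    have h2 := RingHom.map_mulVec (evalRingHom (0 : K)) N.adjugate
      (fun i => C (b.repr x i)) i
    have h3 : N.adjugate.map (evalRingHom (0 : K)) = 1 := by
      have := RingHom.map_adjugate (evalRingHom (0 : K)) N
      rw [RingHom.mapMatrix_apply, RingHom.mapMatrix_apply, hN] at this
      rw [this]
      simp
    rw [h3, Matrix.one_mulVec] at h2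
    simpa [g] using h2

theorem exists_polynomial_det {n : ℕ} (g : Fin n → K[X]) (B : Fin n → (E →ₗ[K] E)) :
    ∃ Q : K[X], ∀ t, Q.eval t = LinearMap.det (∑ i, (g i).eval t • B i) := by
  let b := Module.finBasis K E
  refine ⟨(∑ i, g i • (LinearMap.toMatrix b b (B i)).map C).det, fun t => ?_⟩
  rw [← coe_evalRingHom, RingHom.map_det, ← LinearMap.det_toMatrix b]
  congr 1
  ext i j
  simp [Matrix.sum_apply]

end PolynomialFamilies

/-! ### Rigid representations and finiteness of isomorphism classes -/

namespace QuiverRep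

variable {K : Type u} [Field K] {V : Type u} [Quiver.{v} V]

/-- Extensions by a quotient lift to extensions by the representation. -/
theorem ExtVanishes.of_surjective {M N N' : QuiverRep.{w} K V} (h : ExtVanishes M N)
    (f : Fam N N') (hf : IsHom f) (hsurj : ∀ i, Function.Surjective (f i)) :
    ExtVanishes M N' := by
  intro c
  choose s hs using fun i => (f i).exists_rightInverse_of_surjective
    (LinearMap.range_eq_top.2 (hsurj i))
  obtain ⟨k, hk⟩ := h fun a => s a.2.1 ∘ₗ c a
  refine ⟨comp f k, ?_⟩
  funext ⟨i, j, a⟩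
  ext x
  have h1 := LinearMap.congr_fun (congrFun hk ⟨i, j, a⟩) x
  rw [delta_apply] at h1 ⊢
  rw [comp_apply, comp_apply, ← hf a, ← map_sub, h1]
  exact LinearMap.congr_fun (hs j) _

/-- Two representations are isomorphic. -/
def IsIsomorphic (X Y : QuiverRep.{w} K V) : Prop :=
  ∃ f : Fam X Y, IsHom f ∧ ∀ i, Function.Bijective (f i)

theorem IsIsomorphic.symm {X Y : QuiverRep.{w} K V} (h : IsIsomorphic X Y) : IsIsomorphic Y X := by
  obtain ⟨f, hf, hb⟩ := h
  obtain ⟨g, hg, hgf, hfg⟩ := exists_inverse hf hb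
  exact ⟨g, hg, fun i => ⟨Function.LeftInverse.injective (hfg i),
    Function.RightInverse.surjective (hgf i)⟩⟩

theorem IsIsomorphic.trans {X Y Z : QuiverRep.{w} K V} (h : IsIsomorphic X Y)
    (h' : IsIsomorphic Y Z) : IsIsomorphic X Z := by
  obtain ⟨f, hf, hb⟩ := h
  obtain ⟨g, hg, hb'⟩ := h'
  exact ⟨comp g f, hg.comp hf, fun i => (hb' i).comp (hb i)⟩

theorem IsIsomorphic.extVanishes {X Y : QuiverRep.{w} K V} (h : IsIsomorphic X Y)
    (hX : ExtVanishes X X) : ExtVanishes Y Y := by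
  obtain ⟨g, hg, hgb⟩ := h.symm
  obtain ⟨f, hf, hfb⟩ := h
  exact (hX.of_injective g hg fun i => (hgb i).1).of_surjective f hf fun i => (hfb i).2

/-- The representation with the same vector spaces and other maps along the arrows. -/
abbrev withMaps (X : QuiverRep.{w} K V) (m : ArrowFam X X) : QuiverRep.{w} K V :=
  { X with map := fun a => m ⟨_, _, a⟩ }

/-- Transport of structure makes all representations of one dimension vector points of the single
vector space `ArrowFam X X`. -/
theorem exists_isIsomorphic_withMaps {X Y : QuiverRep.{w} K V}
    (h : ∀ i, Module.finrank K (X.space i) = Module.finrank K (Y.space i)) :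
    ∃ m, IsIsomorphic (X.withMaps m) Y := by
  let e := fun i => LinearEquiv.ofFinrankEq (X.space i) (Y.space i) (h i)
  refine ⟨fun a => (e a.2.1).symm.toLinearMap ∘ₗ Y.map a.2.2 ∘ₗ (e a.1).toLinearMap,
    fun i => (e i).toLinearMap, fun i j a x => ?_, fun i => (e i).bijective⟩
  exact (e j).apply_symm_apply _

open Polynomial in
/-- The representations isomorphic to a given rigid one are generic on every line. -/
theorem ExtVanishes.exists_polynomial [Fintype V] [∀ i j : V, Fintype (i ⟶ j)]
    (X : QuiverRep.{w} K V) (m n : ArrowFam X X)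
    (h : ExtVanishes (X.withMaps m) (X.withMaps m)) :
    ∃ P : K[X], P ≠ 0 ∧ ∀ t, P.eval t ≠ 0 →
      IsIsomorphic (X.withMaps m) (X.withMaps (m + t • n)) := by
  obtain ⟨σ, hσ⟩ := (delta (X.withMaps m) (X.withMaps m)).exists_rightInverse_of_surjective
    (LinearMap.range_eq_top.2 h)
  have hσ' : ∀ c, delta (X.withMaps m) (X.withMaps m) (σ c) = c :=
    fun c => LinearMap.congr_fun hσ c
  let η : Fam X X →ₗ[K] ArrowFam X X :=
    { toFun := fun f a => n a ∘ₗ f a.1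
      map_add' := fun f g => by ext a x; simp
      map_smul' := fun r f => by ext a x; simp }
  -- A morphism from `m` to `m + t • n` is a family `f` with `delta f = -t • η f`. Since `delta`
  -- kills the identity and `σ` is a section of it, every solution of `f = -t • σ (η f) + c • id` is
  -- one. At `t = 0` it is the identity, so its determinants are nonzero polynomials.
  obtain ⟨k, g, b, hw, hw0⟩ := exists_polynomial_solution (-(σ ∘ₗ η)) X.idFam
  choose Q hQ using fun i => exists_polynomial_det g (fun l => b l i)
  have hQ0 : ∀ i, (Q i).eval 0 = 1 := by
    intro i
    rw [hQ]
    have := congrFun hw0 i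
    rw [Finset.sum_apply] at this
    refine (congrArg LinearMap.det this).trans ?_
    exact LinearMap.det_id
  refine ⟨∏ i, Q i, fun h0 => ?_, fun t ht => ?_⟩
  · have := congrArg (eval 0) h0
    rw [eval_prod] at this
    simp [hQ0] at this
  · refine ⟨∑ l, (g l).eval t • b l, ?_, fun i => ?_⟩
    · obtain ⟨c, hc⟩ := hw t
      have hid : delta (X.withMaps m) (X.withMaps m) X.idFam = 0 :=
        (delta_eq_zero_iff _).2 (isHom_id (X.withMaps m))
      generalize (∑ l, (g l).eval t • b l) = f at hc ⊢
      have h1 : delta (X.withMaps m) (X.withMaps m) f = -(t • η f) := by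
        conv_lhs => rw [hc]
        refine (map_add _ _ _).trans ?_
        rw [map_smul, map_smul, hid, smul_zero, add_zero]
        change t • delta (X.withMaps m) (X.withMaps m) (-(σ (η f))) = _
        rw [map_neg, hσ', smul_neg]
      intro i j a x
      have h2 := LinearMap.congr_fun (congrFun h1 ⟨i, j, a⟩) x
      rw [delta_apply] at h2
      change m ⟨i, j, a⟩ (f i x) - f j (m ⟨i, j, a⟩ x) = -(t • n ⟨i, j, a⟩ (f i x)) at h2
      change f j (m ⟨i, j, a⟩ x) = m ⟨i, j, a⟩ (f i x) + t • n ⟨i, j, a⟩ (f i x)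
      rw [sub_eq_iff_eq_add] at h2
      rw [h2]
      abel
    · rw [eval_prod, Finset.prod_ne_zero_iff] at ht
      have h1 := ht i (Finset.mem_univ i)
      rw [hQ] at h1
      rw [Finset.sum_apply]
      exact ((Module.End.isUnit_iff _).1
        ((LinearMap.isUnit_iff_isUnit_det _).2 (isUnit_iff_ne_zero.2 h1)))

open Polynomial in
/-- Over an infinite field, rigid representations of the same dimension are isomorphic. -/
theorem isIsomorphic_of_extVanishes [Infinite K] [Fintype V] [∀ i j : V, Fintype (i ⟶ j)]
    {X Y : QuiverRep.{w} K V} (hX : ExtVanishes X X) (hY : ExtVanishes Y Y)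
    (h : ∀ i, Module.finrank K (X.space i) = Module.finrank K (Y.space i)) :
    IsIsomorphic X Y := by
  obtain ⟨m, hm⟩ := exists_isIsomorphic_withMaps h
  let m₀ : ArrowFam X X := fun a => X.map a.2.2
  obtain ⟨P, hP, hP'⟩ := ExtVanishes.exists_polynomial X m₀ (m - m₀) hX
  obtain ⟨Q, hQ, hQ'⟩ := ExtVanishes.exists_polynomial X m (m₀ - m) (hm.symm.extVanishes hY)
  -- The line through `m₀` and `m` is parametrised from both ends, hence `1 - t` in `Q`. Over an
  -- infinite field some point avoids the zeros of both polynomials, and it is isomorphic to both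
  -- ends.
  obtain ⟨t, ht⟩ : ∃ t, (P * Q.comp (1 - Polynomial.X)).eval t ≠ 0 := by
    by_contra hne
    push Not at hne
    have h0 : P * Q.comp (1 - Polynomial.X) = 0 :=
      Polynomial.funext fun t => (hne t).trans eval_zero.symm
    refine hQ (Polynomial.funext fun t => ?_)
    have h1 := congrArg (eval (1 - t)) ((mul_eq_zero.1 h0).resolve_left hP)
    simpa using h1
  rw [eval_mul, mul_ne_zero_iff, eval_comp] at ht
  have h1 := hP' t ht.1
  have h2 := hQ' (1 - t) (by simpa using ht.2)
  have h3 : m₀ + t • (m - m₀) = m + (1 - t) • (m₀ - m) := by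
    rw [sub_smul, one_smul, smul_sub, smul_sub]
    abel
  rw [h3] at h1
  exact (h1.trans h2.symm).trans hm

/-- A simply laced Dynkin quiver has only finitely many indecomposable representations. -/
theorem exists_finite_isIsomorphic [Fintype V] [IsSimplyLacedDynkin V]
    [∀ i j : V, Fintype (i ⟶ j)] {α : Type*} (X : α → QuiverRep.{w} K V)
    (hX : ∀ a, (X a).IsIndec) :
    ∃ F : Set α, F.Finite ∧ ∀ a, ∃ b ∈ F, IsIsomorphic (X b) (X a) := by
  obtain ⟨Y, hY⟩ := IsSimplyLacedDynkin.exists_sum_sq_le (V := V)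
  obtain ⟨B, hB⟩ := exists_bound_of_sum_sq_le (V := V) Y
  have hfam : ∀ Z : QuiverRep.{w} K V, (Module.finrank K (Fam Z Z) : ℤ) -
      Module.finrank K (ArrowFam Z Z) = ∑ i, (Module.finrank K (Z.space i) : ℤ) *
        Module.finrank K (Z.space i) - ∑ i, ∑ j, Fintype.card (i ⟶ j) *
          ((Module.finrank K (Z.space i) : ℤ) * Module.finrank K (Z.space j)) := by
    intro Z
    rw [finrank_fam, finrank_arrowFam]
    push_cast
    rfl
  -- If the dimension count for bricks failed, the Tits form at the dimension vector would be
  -- nonpositive, forcing `P = 0`.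
  have hrig : ∀ P : QuiverRep.{w} K V, P.IsIndec → P.IsBrick → ExtVanishes P P := by
    intro P hP hb
    refine hb.extVanishes ?_
    by_contra hlt
    have h1 := hY fun i => Module.finrank K (P.space i)
    rw [← hfam] at h1
    have h2 : ∑ i, (Module.finrank K (P.space i) : ℤ) ^ 2 ≤ 0 :=
      h1.trans (mul_nonpos_of_nonneg_of_nonpos (by positivity) (by omega))
    refine hP.nontrivial ?_
    funext i
    have h3 := (Finset.sum_eq_zero_iff_of_nonneg fun i _ => sq_nonneg _).1
      (le_antisymm h2 (Finset.sum_nonneg fun i _ => sq_nonneg _)) i (Finset.mem_univ i)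
    have h4 : Module.finrank K (P.space i) = 0 := by exact_mod_cast pow_eq_zero_iff two_ne_zero |>.1 h3
    have := Module.finrank_zero_iff.1 h4
    exact LinearMap.ext fun x => Subsingleton.elim _ _
  have hbrick : ∀ a, (X a).IsBrick := fun a => (hX a).isBrick hrig
  have hext : ∀ a, ExtVanishes (X a) (X a) := fun a => hrig _ (hX a) (hbrick a)
  have hbound : ∀ a i, Module.finrank K ((X a).space i) ≤ B := by
    intro a
    refine hB (fun i => Module.finrank K ((X a).space i)) ?_
    refine (hY fun i => (Module.finrank K ((X a).space i) : ℤ)).trans ?_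
    rw [← hfam]
    have h1 := (hbrick a).finrank_fam_le (hX a).nontrivial (hext a)
    have h2 : ((X a).dim : ℤ) = ∑ i, (Module.finrank K ((X a).space i) : ℤ) := by
      rw [dim]
      push_cast
      rfl
    rw [← h2]
    exact mul_le_mul_of_nonneg_left (by omega) (by positivity)
  have hfib : ∀ d : V → Fin (B + 1), ∃ F : Set α, F.Finite ∧
      ∀ a, (∀ i, Module.finrank K ((X a).space i) = d i) →
        ∃ b ∈ F, IsIsomorphic (X b) (X a) := by
    intro d
    by_cases hne : ∃ a₀, ∀ i, Module.finrank K ((X a₀).space i) = d i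
    · obtain ⟨a₀, ha₀⟩ := hne
      -- The genericity argument needs an infinite field; over a finite one the set of arrow
      -- families is itself finite.
      rcases finite_or_infinite K with hK | hK
      · have : Finite (ArrowFam (X a₀) (X a₀)) := Module.finite_of_finite K
        have hch : ∀ m : ArrowFam (X a₀) (X a₀), ∃ b, (∃ a, IsIsomorphic ((X a₀).withMaps m) (X a)) →
            IsIsomorphic ((X a₀).withMaps m) (X b) := by
          intro m
          by_cases hm : ∃ a, IsIsomorphic ((X a₀).withMaps m) (X a)
          · exact ⟨hm.choose, fun _ => hm.choose_spec⟩
          · exact ⟨a₀, fun h => absurd h hm⟩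
        choose b hb using hch
        refine ⟨Set.range b, Set.finite_range b, fun a ha => ?_⟩
        obtain ⟨m, hm⟩ := exists_isIsomorphic_withMaps (X := X a₀) (Y := X a)
          fun i => (ha₀ i).trans (ha i).symm
        exact ⟨b m, ⟨m, rfl⟩, (hb m ⟨a, hm⟩).symm.trans hm⟩
      · exact ⟨{a₀}, Set.finite_singleton a₀, fun a ha => ⟨a₀, rfl,
          isIsomorphic_of_extVanishes (hext a₀) (hext a) fun i => (ha₀ i).trans (ha i).symm⟩⟩
    · exact ⟨∅, Set.finite_empty, fun a ha => absurd ⟨a, ha⟩ hne⟩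
  choose F hF hF' using hfib
  refine ⟨⋃ d, F d, Set.finite_iUnion hF, fun a => ?_⟩
  obtain ⟨b, hb, h⟩ := hF' (fun i => ⟨_, Nat.lt_succ_of_le (hbound a i)⟩) a fun i => rfl
  exact ⟨b, Set.mem_iUnion.2 ⟨_, hb⟩, h⟩

end QuiverRep

/-! ### Right modules over the path algebra as representations -/

namespace PathAlgebra

open MulOpposite

section

variable {K : Type u} [Field K] {V : Type u} [Quiver.{u} V] [Fintype V]
  {M N : Type u} [AddCommGroup M] [Module K M] [Module (PathAlgebra K V)ᵐᵒᵖ M]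
  [IsScalarTower K (PathAlgebra K V)ᵐᵒᵖ M]
  [AddCommGroup N] [Module K N] [Module (PathAlgebra K V)ᵐᵒᵖ N]
  [IsScalarTower K (PathAlgebra K V)ᵐᵒᵖ N]

variable (K M) in
/-- The right action of a path on a module. -/
noncomputable def pathAct {a b : V} (p : Quiver.Path a b) : M →ₗ[K] M where
  toFun m := op (single K p) • m
  map_add' x y := smul_add _ x y
  map_smul' r x := by
    have : SMulCommClass K (PathAlgebra K V)ᵐᵒᵖ M := IsScalarTower.to_smulCommClass
    exact (smul_comm r (op (single K p)) x).symm

theorem pathAct_apply {a b : V} (p : Quiver.Path a b) (m : M) :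
    pathAct K M p m = op (single K p) • m := rfl

theorem pathAct_comp {a b c : V} (p : Quiver.Path a b) (q : Quiver.Path b c) (m : M) :
    pathAct K M (p.comp q) m = pathAct K M q (pathAct K M p m) := by
  rw [pathAct_apply, pathAct_apply, pathAct_apply, ← mul_smul, ← op_mul, single_mul_single]

theorem pathAct_pathAct_of_ne {a b c d : V} (p : Quiver.Path a b) (q : Quiver.Path c d)
    (h : b ≠ c) (m : M) : pathAct K M q (pathAct K M p m) = 0 := by
  rw [pathAct_apply, pathAct_apply, ← mul_smul, ← op_mul, single_mul_single_of_ne K p q h, MulOpposite.op_zero,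
    zero_smul]

theorem sum_pathAct_nil (m : M) :
    ∑ i : V, pathAct K M (Quiver.Path.nil : Quiver.Path i i) m = m := by
  simp only [pathAct_apply]
  rw [← Finset.sum_smul, ← Finset.op_sum, ← one_def, op_one, one_smul]

theorem map_pathAct (g : M →ₗ[(PathAlgebra K V)ᵐᵒᵖ] N) {a b : V} (p : Quiver.Path a b) (m : M) :
    g (pathAct K M p m) = pathAct K N p (g m) := g.map_smul _ _

/-- An additive map compatible with the actions of the paths is linear. -/
theorem map_smul_of_pathAct (F : M →ₗ[K] N)
    (h : ∀ {a b : V} (p : Quiver.Path a b) (m : M), F (pathAct K M p m) = pathAct K N p (F m))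
    (r : (PathAlgebra K V)ᵐᵒᵖ) (m : M) : F (r • m) = r • F m := by
  let L := (opLinearEquiv K : PathAlgebra K V ≃ₗ[K] (PathAlgebra K V)ᵐᵒᵖ).toLinearMap
  have := LinearMap.congr_fun (linearMap_ext
    (f := F ∘ₗ ((LinearMap.toSpanSingleton (PathAlgebra K V)ᵐᵒᵖ M m).restrictScalars K) ∘ₗ L)
    (g := ((LinearMap.toSpanSingleton (PathAlgebra K V)ᵐᵒᵖ N (F m)).restrictScalars K) ∘ₗ L)
    fun a b p => h p m) (unop r)
  exact this

variable (K M) in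
/-- The part of a module at a vertex. -/
noncomputable def vertexSpace (i : V) : Submodule K M :=
  LinearMap.range (pathAct K M (Quiver.Path.nil : Quiver.Path i i))

theorem pathAct_mem {a b : V} (p : Quiver.Path a b) (m : M) :
    pathAct K M p m ∈ vertexSpace K M b :=
  ⟨pathAct K M p m, (pathAct_comp p Quiver.Path.nil m).symm⟩

theorem pathAct_nil_of_mem {i : V} {m : M} (h : m ∈ vertexSpace K M i) :
    pathAct K M (Quiver.Path.nil : Quiver.Path i i) m = m := by
  obtain ⟨x, rfl⟩ := h
  exact (pathAct_comp Quiver.Path.nil Quiver.Path.nil x).symm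

theorem pathAct_of_mem_of_ne {i a b : V} (p : Quiver.Path a b) {m : M}
    (h : m ∈ vertexSpace K M i) (hi : i ≠ a) : pathAct K M p m = 0 := by
  obtain ⟨x, rfl⟩ := h
  exact pathAct_pathAct_of_ne _ p hi x

variable [FiniteDimensional K M] [FiniteDimensional K N]

variable (K V M) in
/-- The representation of the quiver given by a module over the path algebra. -/
noncomputable abbrev toRep : QuiverRep.{u} K V where
  space i := vertexSpace K M i
  map a := (pathAct K M a.toPath).restrict fun m _ => pathAct_mem _ m

variable (K M) in
/-- The projection of a module to its part at a vertex. -/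
noncomputable def toVertex (i : V) : M →ₗ[K] (toRep K V M).space i :=
  (pathAct K M (Quiver.Path.nil : Quiver.Path i i)).rangeRestrict

theorem coe_toVertex (i : V) (m : M) :
    (toVertex K M i m : M) = pathAct K M (Quiver.Path.nil : Quiver.Path i i) m := rfl

theorem toVertex_coe {i : V} (x : (toRep K V M).space i) : toVertex K M i (x : M) = x :=
  Subtype.ext (pathAct_nil_of_mem x.2)

theorem toVertex_coe_of_ne {i j : V} (h : i ≠ j) (x : (toRep K V M).space i) :
    toVertex K M j (x : M) = 0 :=
  Subtype.ext (pathAct_of_mem_of_ne _ x.2 h)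

theorem sum_toVertex (m : M) : ∑ i : V, (toVertex K M i m : M) = m := sum_pathAct_nil m

theorem coe_map {i j : V} (a : i ⟶ j) (x : (toRep K V M).space i) :
    ((toRep K V M).map a x : M) = pathAct K M a.toPath (x : M) := rfl

variable (K V) in
/-- The morphism of representations given by a linear map. -/
noncomputable def mapRep (g : M →ₗ[(PathAlgebra K V)ᵐᵒᵖ] N) :
    QuiverRep.Fam (toRep K V M) (toRep K V N) := fun i =>
  (g.restrictScalars K).restrict (p := vertexSpace K M i) (q := vertexSpace K N i) (by
    rintro _ ⟨m, rfl⟩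
    exact ⟨g m, (map_pathAct g _ m).symm⟩)

theorem coe_mapRep (g : M →ₗ[(PathAlgebra K V)ᵐᵒᵖ] N) (i : V) (x : (toRep K V M).space i) :
    (mapRep K V g i x : N) = g x := rfl

theorem isHom_mapRep (g : M →ₗ[(PathAlgebra K V)ᵐᵒᵖ] N) : QuiverRep.IsHom (mapRep K V g) :=
  fun _ _ _ _ => Subtype.ext (map_pathAct g _ _)

theorem linearMap_ext_vertex {N' : Type*} [AddCommGroup N'] [Module (PathAlgebra K V)ᵐᵒᵖ N']
    {F G : M →ₗ[(PathAlgebra K V)ᵐᵒᵖ] N'}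
    (h : ∀ (i : V) (x : (toRep K V M).space i), F x = G x) : F = G := by
  ext m
  rw [← sum_toVertex (K := K) (V := V) m, map_sum, map_sum]
  exact Finset.sum_congr rfl fun i _ => h i _

/-- Morphisms of representations come from linear maps. -/
theorem exists_linearMap_of_isHom (f : QuiverRep.Fam (toRep K V M) (toRep K V N))
    (hf : QuiverRep.IsHom f) :
    ∃ F : M →ₗ[(PathAlgebra K V)ᵐᵒᵖ] N, ∀ i (x : (toRep K V M).space i), F x = f i x := by
  let F : M →ₗ[K] N := ∑ i : V, (vertexSpace K N i).subtype ∘ₗ f i ∘ₗ toVertex K M i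
  have hF : ∀ i (x : (toRep K V M).space i), F x = f i x := by
    intro i x
    simp only [F, LinearMap.sum_apply]
    rw [Finset.sum_eq_single i]
    · exact congrArg (fun y => (f i y : N)) (toVertex_coe x)
    · intro j _ hj
      simp [toVertex_coe_of_ne hj.symm]
    · simp
  -- The arrows generate: compatibility with one arrow at a time extends to paths by induction on
  -- the last arrow.
  have hpath : ∀ {a b : V} (p : Quiver.Path a b) (x : (toRep K V M).space a),
      F (pathAct K M p x) = pathAct K N p (f a x) := by
    intro a b p x
    induction p with
    | nil => rw [pathAct_nil_of_mem x.2, pathAct_nil_of_mem (f a x).2, hF]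
    | @cons b c p α ih =>
      have h1 := pathAct_comp (K := K) p α.toPath (x : M)
      have h2 := pathAct_comp (K := K) p α.toPath (f a x : N)
      rw [Quiver.Path.comp_toPath_eq_cons] at h1 h2
      have h3 := congrArg Subtype.val (hf α ⟨pathAct K M p x, pathAct_mem p _⟩)
      rw [coe_map, ← hF, coe_map, ← hF] at h3
      rw [h1, h2, ← ih]
      exact h3
  refine ⟨{ F with map_smul' := map_smul_of_pathAct F fun {a b} p m => ?_ }, hF⟩
  have h1 : pathAct K M p m = pathAct K M p (toVertex K M a m : M) := by
    rw [coe_toVertex, ← pathAct_comp, Quiver.Path.nil_comp]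
  have h2 : pathAct K N p (F m) = pathAct K N p (f a (toVertex K M a m) : N) := by
    conv_lhs => rw [← sum_toVertex (K := K) (V := V) m, map_sum, map_sum]
    rw [Finset.sum_eq_single a]
    · rw [hF]
    · intro i _ hi
      rw [hF, pathAct_of_mem_of_ne p (f i _).2 hi]
    · simp
  rw [h1, h2, hpath]

/-- Modules with isomorphic representations are isomorphic. -/
theorem nonempty_linearEquiv_of_isIsomorphic
    (h : QuiverRep.IsIsomorphic (toRep K V M) (toRep K V N)) :
    Nonempty (M ≃ₗ[(PathAlgebra K V)ᵐᵒᵖ] N) := by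
  obtain ⟨f, hf, hb⟩ := h
  obtain ⟨g, hg, hgf, hfg⟩ := QuiverRep.exists_inverse hf hb
  obtain ⟨F, hF⟩ := exists_linearMap_of_isHom f hf
  obtain ⟨G, hG⟩ := exists_linearMap_of_isHom g hg
  refine ⟨LinearEquiv.ofLinearMap F G ?_ ?_⟩
  · refine linearMap_ext_vertex (K := K) fun i x => ?_
    rw [LinearMap.comp_apply, hG, hF, hfg]
    rfl
  · refine linearMap_ext_vertex (K := K) fun i x => ?_
    rw [LinearMap.comp_apply, hF, hG, hgf]
    rfl

/-- A nonzero module without nontrivial idempotent endomorphisms gives an indecomposable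
representation. -/
theorem isIndec_toRep [Nontrivial M] (h : ∀ e : M →ₗ[(PathAlgebra K V)ᵐᵒᵖ] M,
    e ∘ₗ e = e → e = 0 ∨ e = LinearMap.id) : (toRep K V M).IsIndec where
  nontrivial h0 := by
    obtain ⟨m, hm⟩ := exists_ne (0 : M)
    refine hm ?_
    rw [← sum_toVertex (K := K) (V := V) m]
    refine Finset.sum_eq_zero fun i _ => ?_
    have := LinearMap.congr_fun (congrFun h0 i) (toVertex K M i m)
    exact congrArg Subtype.val this
  idempotent e he hee := by
    obtain ⟨F, hF⟩ := exists_linearMap_of_isHom e he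
    rcases h F (linearMap_ext_vertex (K := K) fun i x => by
      rw [LinearMap.comp_apply, hF, hF]
      exact congrArg Subtype.val (LinearMap.congr_fun (congrFun hee i) x)) with h0 | h1
    · left
      funext i
      ext x
      rw [← hF, h0]
      rfl
    · right
      funext i
      ext x
      rw [← hF, h1]
      rfl

end

/-! ### The path algebra is hereditary -/

section Hereditary

variable {K : Type u} [Field K] {V : Type u} [Quiver.{u} V] [Fintype V]

/-- The solution of the defining equation of the extension group along a path. -/
noncomputable def liftPath (N : QuiverRep.{w} K V)
    (c : ∀ {a i j : V} (_ : Quiver.Path a i) (_ : i ⟶ j), N.space j) :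
    ∀ {a b : V}, Quiver.Path a b → N.space b
  | _, _, .nil => 0
  | _, _, .cons p α => N.map α (liftPath N c p) - c p α

/-- Finite free modules have no extensions. -/
theorem extVanishes_free [FiniteDimensional K (PathAlgebra K V)] (n : ℕ) (N : QuiverRep.{u} K V) :
    QuiverRep.ExtVanishes (toRep K V (Fin n → (PathAlgebra K V)ᵐᵒᵖ)) N := by
  classical
  intro c
  let incl : Fin n → PathAlgebra K V →ₗ[K] (Fin n → (PathAlgebra K V)ᵐᵒᵖ) := fun k =>
    LinearMap.single K (fun _ => (PathAlgebra K V)ᵐᵒᵖ) k ∘ₗ (opLinearEquiv K).toLinearMap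
  have hincl : ∀ k {a b c : V} (p : Quiver.Path a b) (q : Quiver.Path b c),
      pathAct K (Fin n → (PathAlgebra K V)ᵐᵒᵖ) q (incl k (single K p)) =
        incl k (single K (p.comp q)) := by
    intro k a b c p q
    rw [← single_mul_single, pathAct_apply]
    change op (single K q) • Pi.single k (op (single K p)) = Pi.single k (op _)
    rw [← Pi.single_smul]
    rfl
  have hincl' : ∀ k {a b c d : V} (p : Quiver.Path a b) (q : Quiver.Path c d), b ≠ c →
      pathAct K (Fin n → (PathAlgebra K V)ᵐᵒᵖ) q (incl k (single K p)) = 0 := by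
    intro k a b c d p q h
    rw [← Quiver.Path.comp_nil p, ← hincl, pathAct_pathAct_of_ne _ _ h]
  let c' : ∀ k {a i j : V} (_ : Quiver.Path a i) (_ : i ⟶ j), N.space j := fun k {a i j} p α =>
    c ⟨i, j, α⟩ (toVertex K _ i (incl k (single K p)))
  -- Paths in each coordinate form a basis of the free module, and the arrow `α` carries `p` to `p
  -- α`. The equation for `c` thus prescribes the value at `p α` from that at `p`, with the free
  -- initial value `0` on trivial paths.
  let G : ∀ (_ : Fin n) (j : V), PathAlgebra K V →ₗ[K] N.space j := fun k j =>
    (basis K V).constr K fun x => if h : x.2.1 = j then h ▸ liftPath N (c' k) x.2.2 else 0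
  have hG : ∀ k {a b : V} (p : Quiver.Path a b), G k b (single K p) = liftPath N (c' k) p := by
    intro k a b p
    refine ((basis K V).constr_basis K _ ⟨a, b, p⟩).trans ?_
    simp
  have hG' : ∀ k {a b j : V} (p : Quiver.Path a b), b ≠ j → G k j (single K p) = 0 := by
    intro k a b j p h
    refine ((basis K V).constr_basis K _ ⟨a, b, p⟩).trans ?_
    simp [h]
  let H : ∀ j : V, (Fin n → (PathAlgebra K V)ᵐᵒᵖ) →ₗ[K] N.space j := fun j =>
    ∑ k, G k j ∘ₗ (opLinearEquiv K).symm.toLinearMap ∘ₗ LinearMap.proj k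
  have hH : ∀ k j (x : PathAlgebra K V), H j (incl k x) = G k j x := by
    intro k j x
    simp only [H, LinearMap.sum_apply]
    rw [Finset.sum_eq_single k]
    · simp [incl]
    · intro l _ hl
      simp [incl, hl]
    · simp
  have key : ∀ {i j : V} (α : i ⟶ j),
      N.map α ∘ₗ H i - H j ∘ₗ pathAct K _ α.toPath = c ⟨i, j, α⟩ ∘ₗ toVertex K _ i := by
    intro i j α
    refine LinearMap.pi_ext' fun k => ?_
    suffices h : (N.map α ∘ₗ H i - H j ∘ₗ pathAct K _ α.toPath) ∘ₗ incl k =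
        (c ⟨i, j, α⟩ ∘ₗ toVertex K _ i) ∘ₗ incl k by
      ext x
      exact LinearMap.congr_fun h (unop x)
    refine linearMap_ext fun a b p => ?_
    simp only [LinearMap.comp_apply, LinearMap.sub_apply, hH]
    by_cases hb : b = i
    · subst hb
      rw [hincl, hH, hG, hG, Quiver.Path.comp_toPath_eq_cons, liftPath, sub_sub_cancel]
    · rw [hincl' k p _ hb, hG' k p hb, map_zero, map_zero, sub_zero]
      have : toVertex K (Fin n → (PathAlgebra K V)ᵐᵒᵖ) i (incl k (single K p)) = 0 :=
        Subtype.ext (hincl' k p _ hb)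
      rw [this, map_zero]
  refine ⟨fun i => H i ∘ₗ (vertexSpace K _ i).subtype, ?_⟩
  funext ⟨i, j, α⟩
  ext x
  have h1 := LinearMap.congr_fun (key α) (x : Fin n → (PathAlgebra K V)ᵐᵒᵖ)
  rw [LinearMap.comp_apply (c ⟨i, j, α⟩), toVertex_coe] at h1
  exact h1

/-- The path algebra is hereditary: submodules of finite free modules are projective. -/
theorem projective_of_injective [FiniteDimensional K (PathAlgebra K V)]
    {M : Type u} [AddCommGroup M] [Module K M] [Module (PathAlgebra K V)ᵐᵒᵖ M]
    [IsScalarTower K (PathAlgebra K V)ᵐᵒᵖ M] [FiniteDimensional K M]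
    [Module.Finite (PathAlgebra K V)ᵐᵒᵖ M] (n : ℕ)
    (f : M →ₗ[(PathAlgebra K V)ᵐᵒᵖ] (Fin n → (PathAlgebra K V)ᵐᵒᵖ)) (hf : Function.Injective f) :
    Module.Projective (PathAlgebra K V)ᵐᵒᵖ M := by
  obtain ⟨m, q, hq⟩ := Module.Finite.exists_fin' (PathAlgebra K V)ᵐᵒᵖ M
  have hM : ∀ N : QuiverRep.{u} K V, QuiverRep.ExtVanishes (toRep K V M) N := fun N =>
    (extVanishes_free n N).of_injective (mapRep K V f) (isHom_mapRep f) fun i x y h =>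
      Subtype.ext (hf (congrArg Subtype.val h))
  have : FiniteDimensional K (LinearMap.ker q) :=
    inferInstanceAs (FiniteDimensional K ((LinearMap.ker q).restrictScalars K))
  -- Extending the identity of `ker q` gives a retraction of the free cover onto `ker q`, so the
  -- cover splits.
  obtain ⟨r, hr, hrι⟩ := (hM (toRep K V (LinearMap.ker q))).exists_extension (mapRep K V q)
    (isHom_mapRep q) (fun i x => by
      obtain ⟨y, hy⟩ := hq x
      refine ⟨toVertex K _ i y, Subtype.ext ?_⟩
      rw [coe_mapRep, coe_toVertex, map_pathAct, hy]
      exact pathAct_nil_of_mem x.2)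
    (mapRep K V (LinearMap.ker q).subtype) (isHom_mapRep _)
    (fun i x y h => Subtype.ext (Subtype.val_injective (congrArg Subtype.val h :)))
    (fun i x hx => by
      have hx' : q x = 0 := congrArg Subtype.val hx
      refine ⟨⟨⟨x, hx'⟩, ⟨x, hx'⟩, Subtype.ext ?_⟩, rfl⟩
      exact pathAct_nil_of_mem x.2)
    (fun i y => Subtype.ext y.1.2) (QuiverRep.idFam _) (QuiverRep.isHom_id _)
  obtain ⟨R, hR⟩ := exists_linearMap_of_isHom r hr
  have hRι : R ∘ₗ (LinearMap.ker q).subtype = LinearMap.id :=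
    linearMap_ext_vertex (K := K) fun i x => by
      rw [LinearMap.comp_apply]
      have := congrArg Subtype.val (hrι i x)
      rw [← hR] at this
      exact this
  have hR' : ∃ l, l ∘ₗ (LinearMap.ker q).subtype = LinearMap.id := ⟨R, hRι⟩
  obtain ⟨s, hs⟩ : ∃ s, q ∘ₗ s = LinearMap.id := (((LinearMap.exact_subtype_ker_map q).split_tfae
    Subtype.val_injective hq).out 1 0).1 hR'
  exact Module.Projective.of_split s q hs

end Hereditary

end PathAlgebra

/-! ### Bounded derived categories of hereditary abelian categories -/

section DerivedHereditary

variable {A : Type v} [Category.{u} A] [Abelian A] [HasDerivedCategory.{w} A]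

open DerivedCategory.TStructure Triangulated

variable (A) in
/-- The inclusion of an abelian category in its bounded derived category. -/
noncomputable def stalkFunctor : A ⥤ DerivedCategory.Bounded A :=
  (t (C := A)).bounded.lift (DerivedCategory.singleFunctor A 0)
    fun _ => ⟨⟨0, inferInstance⟩, ⟨0, inferInstance⟩⟩

instance : (stalkFunctor A).Additive where
  map_add {X Y f g} := by
    refine DerivedCategory.Bounded.ι.map_injective ?_
    exact (DerivedCategory.singleFunctor A 0).map_add

/-- Stalk complexes of an object of projective dimension at most one have no morphisms of degree
at least two. -/
theorem stalkObj_hom_shift_eq_zero {X Y : A} [HasProjectiveDimensionLT X 2] {k : ℤ} (hk : 2 ≤ k)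
    (f : stalkObj X ⟶ (stalkObj Y)⟦k⟧) : f = 0 := by
  have : HasExt.{w} A := hasExt_of_hasDerivedCategory A
  lift k to ℕ using by omega
  have h0 : ∀ g : ShiftedHom ((DerivedCategory.singleFunctor A 0).obj X)
      ((DerivedCategory.singleFunctor A 0).obj Y) (k : ℤ), g = 0 := by
    intro g
    obtain ⟨e, rfl⟩ := Abelian.Ext.homEquiv.surjective g
    rw [Abelian.Ext.eq_zero_of_hasProjectiveDimensionLT e 2 (by exact_mod_cast hk)]
    exact Abelian.Ext.zero_hom ..
  refine DerivedCategory.Bounded.ι.map_injective ?_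
  rw [Functor.map_zero,
    ← cancel_mono ((DerivedCategory.Bounded.ι.commShiftIso (k : ℤ)).hom.app (stalkObj Y)), zero_comp]
  exact h0 _

theorem stalkObj_shift_hom_shift_eq_zero {X Y : A} [HasProjectiveDimensionLT X 2] {a b : ℤ}
    (h : a + 2 ≤ b) (f : (stalkObj X)⟦a⟧ ⟶ (stalkObj Y)⟦b⟧) : f = 0 := by
  refine (shiftFunctor (DerivedCategory.Bounded A) (-a)).map_injective ?_
  rw [Functor.map_zero]
  let e₁ := (shiftFunctorCompIsoId (DerivedCategory.Bounded A) a (-a) (by omega)).app (stalkObj X)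
  let e₂ := (shiftFunctorAdd' (DerivedCategory.Bounded A) b (-a) (b - a) (by omega)).app
    (stalkObj Y)
  rw [← cancel_epi e₁.inv, ← cancel_mono e₂.inv, comp_zero, zero_comp]
  exact stalkObj_hom_shift_eq_zero (by omega) _

/-- Complexes concentrated in one degree are shifts of objects. -/
theorem exists_iso_stalkObj_shift (X : DerivedCategory.Bounded A) (n : ℤ)
    [h₁ : t.onBounded.IsGE X n] [h₂ : t.onBounded.IsLE X n] :
    ∃ M : A, Nonempty (X ≅ (stalkObj M)⟦-n⟧) := by
  have := (ObjectProperty.tStructure_isGE_iff _ _ X n).1 h₁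
  have := (ObjectProperty.tStructure_isLE_iff _ _ X n).1 h₂
  obtain ⟨M, ⟨e⟩⟩ := DerivedCategory.exists_iso_singleFunctor_obj_of_isGE_of_isLE X.obj n
  let e' := ((DerivedCategory.singleFunctors A).shiftIso (-n) n 0 (by omega)).app M
  let e'' := (DerivedCategory.Bounded.ι.commShiftIso (-n)).app (stalkObj M)
  exact ⟨M, ⟨DerivedCategory.Bounded.ι.preimageIso (e ≪≫ e'.symm ≪≫ e''.symm)⟩⟩

end DerivedHereditary

/-- Exactness of `Hom(S, -)` on the shifted triangle; it carries vanishing from the two truncations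
of a complex to the complex. -/
theorem hom_shift_eq_zero_of_distTriang {C : Type*} [Category* C] [HasZeroObject C] [HasShift C ℤ]
    [Preadditive C] [∀ n : ℤ, (shiftFunctor C n).Additive] [Pretriangulated C]
    {T : Triangle C} (hT : T ∈ distTriang C) {S : C} {a : ℤ}
    (h₁ : ∀ f : S ⟶ T.obj₁⟦a⟧, f = 0) (h₃ : ∀ f : S ⟶ T.obj₃⟦a⟧, f = 0)
    (f : S ⟶ T.obj₂⟦a⟧) : f = 0 := by
  obtain ⟨g, rfl⟩ := Triangle.coyoneda_exact₂ _ (Triangle.shift_distinguished T hT a) f (h₃ _)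
  rw [h₁ g]
  exact zero_comp

/-! ### Balls of additive metrics -/

namespace GoodMetric

section

open scoped ZeroObject

variable {C : Type*} [Category* C] [HasZeroObject C] [HasShift C ℤ]
  [Preadditive C] [∀ n : ℤ, (shiftFunctor C n).Additive] [Pretriangulated C]

/-- An isomorphism `X ≅ Y` makes `X ⟶ Y ⟶ 0` distinguished, so closure under extensions suffices. -/
theorem ball_of_iso (N : GoodMetric C) (n : ℕ) {X Y : C} (e : X ≅ Y) (h : N.ball n X) :
    N.ball n Y :=
  N.ext_closed n (Triangle.mk e.hom (0 : Y ⟶ 0) 0)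
    (isomorphic_distinguished _ (contractible_distinguished X) _
      (Triangle.isoMk _ _ (Iso.refl _) e.symm (Iso.refl _) (e.hom_inv_id.trans (Category.comp_id _).symm)
        (zero_comp.trans comp_zero.symm) (zero_comp.trans comp_zero.symm))) h
    (N.ball_of_isZero n (isZero_zero C))

theorem ball_biprod (N : GoodMetric C) (n : ℕ) {X Y : C} (hX : N.ball n X) (hY : N.ball n Y) :
    N.ball n (X ⊞ Y) :=
  N.ext_closed n _ (binaryBiproductTriangle_distinguished X Y) hX hY

theorem IsAdditive.left {N : GoodMetric C} (hN : N.IsAdditive) {n : ℕ} {X Y : C}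
    (h : N.ball n (X ⊞ Y)) : N.ball n X := hN n X Y h

theorem IsAdditive.right {N : GoodMetric C} (hN : N.IsAdditive) {n : ℕ} {X Y : C}
    (h : N.ball n (X ⊞ Y)) : N.ball n Y :=
  hN n Y X (N.ball_of_iso n (biprod.braiding X Y) h)

end

section

variable {A : Type v} [Category.{u} A] [Abelian A] [HasDerivedCategory.{w} A]

open DerivedCategory.TStructure Triangulated

/-- In the bounded derived category of a hereditary abelian category, the balls of an additive
good metric are determined by the shifted stalk complexes that they contain. -/
theorem IsAdditive.ball_le_of_stalkObj (hA : ∀ X : A, HasProjectiveDimensionLT X 2)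
    {N D : GoodMetric (DerivedCategory.Bounded A)} (hN : N.IsAdditive) {m n : ℕ}
    (h : ∀ (M : A) (k : ℤ), N.ball m ((stalkObj M)⟦k⟧) → D.ball n ((stalkObj M)⟦k⟧)) :
    N.ball m ≤ D.ball n := by
  -- Induction on the amplitude. The vanishing is carried along because it splits the next
  -- truncation triangle: it concerns stalks in cohomological degree `-k`, strictly above the top
  -- degree `a + l` allowed for `X`.
  have key : ∀ (l : ℕ) (a : ℤ) (X : DerivedCategory.Bounded A), t.onBounded.IsGE X a →
      t.onBounded.IsLE X (a + l) →
      (∀ (M : A) (k : ℤ), k + (a + l) + 1 ≤ 0 → ∀ f : (stalkObj M)⟦k⟧ ⟶ X⟦(1 : ℤ)⟧, f = 0) ∧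
        (N.ball m X → D.ball n X) := by
    intro l
    induction l with
    | zero =>
      intro a X h₁ h₂
      rw [Nat.cast_zero, add_zero] at h₂
      obtain ⟨Y, ⟨e⟩⟩ := exists_iso_stalkObj_shift X a
      refine ⟨fun M k hk f => ?_, fun hX => D.ball_of_iso n e.symm (h Y _ (N.ball_of_iso m e hX))⟩
      let e' := (shiftFunctor (DerivedCategory.Bounded A) (1 : ℤ)).mapIso e ≪≫
        ((shiftFunctorAdd' (DerivedCategory.Bounded A) (-a) 1 (-a + 1) rfl).app (stalkObj Y)).symm
      rw [← cancel_mono e'.hom, zero_comp]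
      exact stalkObj_shift_hom_shift_eq_zero (by omega) _
    | succ l ih =>
      intro a X h₁ h₂
      rw [Nat.cast_succ, ← add_assoc] at h₂
      let T := (t.onBounded.triangleLEGE (a + l) (a + l + 1) rfl).obj X
      have hT : T ∈ distTriang _ := t.onBounded.triangleLEGE_distinguished (a + l) (a + l + 1) rfl X
      have hW : t.onBounded.IsGE T.obj₁ a :=
        inferInstanceAs (t.onBounded.IsGE ((t.onBounded.truncLE (a + l)).obj X) a)
      have hW' : t.onBounded.IsLE T.obj₁ (a + l) :=
        inferInstanceAs (t.onBounded.IsLE ((t.onBounded.truncLE (a + l)).obj X) (a + l))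
      have hZ : t.onBounded.IsLE T.obj₃ (a + l + 1) :=
        inferInstanceAs (t.onBounded.IsLE ((t.onBounded.truncGE (a + l + 1)).obj X) (a + l + 1))
      have hZ' : t.onBounded.IsGE T.obj₃ (a + l + 1) :=
        inferInstanceAs (t.onBounded.IsGE ((t.onBounded.truncGE (a + l + 1)).obj X) (a + l + 1))
      obtain ⟨Y, ⟨e⟩⟩ := exists_iso_stalkObj_shift T.obj₃ (a + l + 1)
      obtain ⟨ih₁, ih₂⟩ := ih a T.obj₁ hW hW'
      -- The connecting map goes from a stalk in degree `a + l + 1` to the shift of a complex in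
      -- degrees at most `a + l`; once it vanishes, `X` is the biproduct of its truncations.
      have h₃ : T.mor₃ = 0 := by
        rw [← cancel_epi e.inv, comp_zero]
        exact ih₁ Y _ (by omega) _
      obtain ⟨i, -⟩ := exists_iso_binaryBiproduct_of_distTriang T hT h₃
      constructor
      · intro M k hk
        refine hom_shift_eq_zero_of_distTriang hT (ih₁ M k (by push_cast at hk; omega)) fun f => ?_
        let e' := (shiftFunctor (DerivedCategory.Bounded A) (1 : ℤ)).mapIso e ≪≫
          ((shiftFunctorAdd' (DerivedCategory.Bounded A) (-(a + l + 1)) 1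
            (-(a + l + 1) + 1) rfl).app (stalkObj Y)).symm
        rw [← cancel_mono e'.hom, zero_comp]
        exact stalkObj_shift_hom_shift_eq_zero (by push_cast at hk; omega) _
      · intro hX
        have hX' : N.ball m (T.obj₁ ⊞ T.obj₃) := N.ball_of_iso m i hX
        refine D.ball_of_iso n i.symm (D.ball_biprod n (ih₂ (hN.left hX')) ?_)
        exact D.ball_of_iso n e.symm (h Y _ (N.ball_of_iso m e (hN.right hX')))
  intro X hX
  obtain ⟨⟨a, ha⟩, ⟨b, hb⟩⟩ := X.property
  have ha' : t.onBounded.IsGE X a := (ObjectProperty.tStructure_isGE_iff _ _ X a).2 ha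
  have hb' : t.onBounded.IsLE X b := (ObjectProperty.tStructure_isLE_iff _ _ X b).2 hb
  exact (key (b - a).toNat a X ha' (t.onBounded.isLE_of_le X b _ (by omega))).2 hX

/-- If moreover the objects have a length, then the balls of an additive good metric are determined
by the shifted indecomposable stalk complexes that they contain. -/
theorem IsAdditive.ball_le_of_indecomposable (hA : ∀ X : A, HasProjectiveDimensionLT X 2)
    (len : A → ℕ) (hlen : ∀ {X Y Z : A}, (X ≅ Y ⊞ Z) → ¬ IsZero Z → len Y < len X)
    {N D : GoodMetric (DerivedCategory.Bounded A)} (hN : N.IsAdditive) {m n : ℕ}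
    (h : ∀ (M : A) (k : ℤ), Indecomposable M →
      N.ball m ((stalkObj M)⟦k⟧) → D.ball n ((stalkObj M)⟦k⟧)) :
    N.ball m ≤ D.ball n := by
  refine hN.ball_le_of_stalkObj hA fun M k => ?_
  induction hl : len M using Nat.strong_induction_on generalizing M with
  | _ l ih =>
  intro hM
  by_cases hM0 : IsZero M
  · exact D.ball_of_isZero n ((shiftFunctor _ k).map_isZero ((stalkFunctor A).map_isZero hM0))
  by_cases hind : Indecomposable M
  · exact h M k hind hM
  · simp only [Indecomposable, not_and, not_forall, not_or] at hind
    obtain ⟨Y, Z, e, hY, hZ⟩ := hind hM0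
    have := preservesBinaryBiproducts_of_preservesBiproducts
      (stalkFunctor A ⋙ shiftFunctor (DerivedCategory.Bounded A) k)
    let e' : (stalkObj M)⟦k⟧ ≅ (stalkObj Y)⟦k⟧ ⊞ (stalkObj Z)⟦k⟧ :=
      (stalkFunctor A ⋙ shiftFunctor _ k).mapIso e ≪≫
        (stalkFunctor A ⋙ shiftFunctor _ k).mapBiprod Y Z
    have hM' := N.ball_of_iso m e' hM
    have hY' : len Y < len M := hlen e hZ
    have hZ' : len Z < len M := hlen (e ≪≫ biprod.braiding Y Z) hY
    exact D.ball_of_iso n e'.symm (D.ball_biprod n (ih _ (hl ▸ hY') Y rfl (hN.left hM'))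
      (ih _ (hl ▸ hZ') Z rfl (hN.right hM')))

end

end GoodMetric

/-! ### The category of finitely generated modules over the path algebra -/

namespace FGModuleCat

variable {R : Type u} [Ring R]

theorem isZero_of_subsingleton {X : FGModuleCat.{v} R} (h : Subsingleton X) : IsZero X := by
  rw [IsZero.iff_id_eq_zero]
  ext x
  exact h.elim _ _

theorem subsingleton_of_isZero {X : FGModuleCat.{v} R} (h : IsZero X) : Subsingleton X := by
  refine ⟨fun x y => ?_⟩
  have h1 : (𝟙 X : X ⟶ X) = 0 := h.eq_of_src _ _
  have h2 : ∀ z : X, z = 0 := fun z => LinearMap.congr_fun (congrArg (fun f => f.hom.hom) h1) z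
  rw [h2 x, h2 y]

variable [IsNoetherianRing R]

theorem injective_of_mono {X Y : FGModuleCat.{v} R} (f : X ⟶ Y) [Mono f] :
    Function.Injective f.hom.hom :=
  (ModuleCat.mono_iff_injective ((forget₂ (FGModuleCat R) (ModuleCat R)).map f)).1 inferInstance

theorem surjective_of_epi {X Y : FGModuleCat.{v} R} (f : X ⟶ Y) [Epi f] :
    Function.Surjective f.hom.hom :=
  (ModuleCat.epi_iff_surjective ((forget₂ (FGModuleCat R) (ModuleCat R)).map f)).1 inferInstance

theorem epi_of_surjective {X Y : FGModuleCat.{v} R} (f : X ⟶ Y)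
    (hf : Function.Surjective f.hom.hom) : Epi f := by
  have : Epi ((forget₂ (FGModuleCat R) (ModuleCat R)).map f) :=
    (ModuleCat.epi_iff_surjective _).2 hf
  exact (forget₂ (FGModuleCat R) (ModuleCat R)).epi_of_epi_map this

theorem projective_of_module {P : FGModuleCat.{v} R} (hP : Module.Projective R P) :
    Projective P where
  factors {E X} f e _ := by
    obtain ⟨h, hh⟩ := Module.projective_lifting_property e.hom.hom f.hom.hom (surjective_of_epi e)
    refine ⟨ofHom h, ?_⟩
    ext x
    exact LinearMap.congr_fun hh x

/-- An idempotent exhibits `M` as the biproduct of its range and kernel, one of which must vanish.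
-/
theorem eq_zero_or_eq_id_of_indecomposable {M : FGModuleCat.{v} R} (hM : Indecomposable M)
    (e : M →ₗ[R] M) (he : e ∘ₗ e = e) : e = 0 ∨ e = LinearMap.id := by
  have he' : ∀ x, e (e x) = e x := fun x => LinearMap.congr_fun he x
  let b : BinaryBicone (of R (LinearMap.range e)) (of R (LinearMap.ker e)) :=
    { pt := M
      fst := ofHom e.rangeRestrict
      snd := ofHom ((LinearMap.id - e).codRestrict (LinearMap.ker e) fun x => by simp [he'])
      inl := ofHom (LinearMap.range e).subtype
      inr := ofHom (LinearMap.ker e).subtype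
      inl_fst := by
        ext ⟨_, x, rfl⟩
        exact he' x
      inl_snd := by
        ext ⟨_, x, rfl⟩
        exact sub_eq_zero.2 (he' x).symm
      inr_fst := by
        ext ⟨x, hx⟩
        exact hx
      inr_snd := by
        ext ⟨x, hx⟩
        change x - e x = x
        rw [LinearMap.mem_ker.1 hx, sub_zero] }
  have hb : b.IsBilimit := isBinaryBilimitOfTotal b (by
    ext x
    exact add_sub_cancel (e x) x)
  rcases hM.2 _ _ (biprod.uniqueUpToIso _ _ hb) with h | h
  · left
    have := subsingleton_of_isZero h
    ext x
    exact congrArg Subtype.val (Subsingleton.elim (e.rangeRestrict x) 0)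
  · right
    have := subsingleton_of_isZero h
    ext x
    have hx : x - e x ∈ LinearMap.ker e := by simp [he']
    have := congrArg Subtype.val (Subsingleton.elim (⟨_, hx⟩ : LinearMap.ker e) 0)
    exact (sub_eq_zero.1 this).symm

end FGModuleCat

namespace ModPathAlgebra

variable {K : Type u} [Field K] {V : Type u} [Fintype V] [Quiver.{u} V]

noncomputable instance (M : ModPathAlgebra K V) : Module K M :=
  Module.compHom M (algebraMap K (PathAlgebra K V)ᵐᵒᵖ)

instance (M : ModPathAlgebra K V) : IsScalarTower K (PathAlgebra K V)ᵐᵒᵖ M :=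
  IsScalarTower.of_algebraMap_smul fun _ _ => rfl

variable [IsSimplyLacedDynkin V]

instance (M : ModPathAlgebra K V) : FiniteDimensional K M :=
  Module.Finite.trans (PathAlgebra K V)ᵐᵒᵖ M

/-- The kernel of a finite free cover embeds in a free module, hence is projective. -/
theorem hasProjectiveDimensionLT_two (M : ModPathAlgebra K V) : HasProjectiveDimensionLT M 2 := by
  obtain ⟨n, q, hq⟩ := Module.Finite.exists_fin' (PathAlgebra K V)ᵐᵒᵖ M
  let P : ModPathAlgebra K V :=
    FGModuleCat.of (PathAlgebra K V)ᵐᵒᵖ (Fin n → (PathAlgebra K V)ᵐᵒᵖ)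
  let f : P ⟶ M := FGModuleCat.ofHom q
  have : Epi f := FGModuleCat.epi_of_surjective f hq
  have hP : Projective P := FGModuleCat.projective_of_module
    (inferInstanceAs (Module.Projective _ (Fin n → (PathAlgebra K V)ᵐᵒᵖ)))
  have hker : Projective (kernel f) := FGModuleCat.projective_of_module
    (PathAlgebra.projective_of_injective (K := K) n (kernel.ι f).hom.hom
      (FGModuleCat.injective_of_mono (kernel.ι f)))
  exact (ShortComplex.ShortExact.mk (ShortComplex.exact_kernel f)).hasProjectiveDimensionLT_X₃ 1
    (inferInstanceAs (HasProjectiveDimensionLT (kernel f) 1))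
    (inferInstanceAs (HasProjectiveDimensionLT P 2))

/-- Makes the dimension over `K` a length function for splitting modules into indecomposables. -/
theorem finrank_lt_of_iso_biprod {X Y Z : ModPathAlgebra K V} (e : X ≅ Y ⊞ Z) (hZ : ¬ IsZero Z) :
    Module.finrank K Y < Module.finrank K X := by
  let g : (Y × Z) →ₗ[K] X :=
    LinearMap.coprod ((biprod.inl ≫ e.inv).hom.hom.restrictScalars K)
      ((biprod.inr ≫ e.inv).hom.hom.restrictScalars K)
  let p : X →ₗ[K] (Y × Z) :=
    LinearMap.prod ((e.hom ≫ biprod.fst).hom.hom.restrictScalars K)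
      ((e.hom ≫ biprod.snd).hom.hom.restrictScalars K)
  have h1 : ∀ y : Y, (e.hom ≫ biprod.fst).hom.hom ((biprod.inl ≫ e.inv).hom.hom y) = y := fun y =>
    LinearMap.congr_fun (congrArg (fun f : Y ⟶ Y => f.hom.hom)
      (by simp : (biprod.inl ≫ e.inv) ≫ e.hom ≫ biprod.fst = 𝟙 Y)) y
  have h2 : ∀ y : Y, (e.hom ≫ biprod.snd).hom.hom ((biprod.inl ≫ e.inv).hom.hom y) = 0 := fun y =>
    LinearMap.congr_fun (congrArg (fun f : Y ⟶ Z => f.hom.hom)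
      (by simp : (biprod.inl ≫ e.inv) ≫ e.hom ≫ biprod.snd = 0)) y
  have h3 : ∀ z : Z, (e.hom ≫ biprod.fst).hom.hom ((biprod.inr ≫ e.inv).hom.hom z) = 0 := fun z =>
    LinearMap.congr_fun (congrArg (fun f : Z ⟶ Y => f.hom.hom)
      (by simp : (biprod.inr ≫ e.inv) ≫ e.hom ≫ biprod.fst = 0)) z
  have h4 : ∀ z : Z, (e.hom ≫ biprod.snd).hom.hom ((biprod.inr ≫ e.inv).hom.hom z) = z := fun z =>
    LinearMap.congr_fun (congrArg (fun f : Z ⟶ Z => f.hom.hom)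
      (by simp : (biprod.inr ≫ e.inv) ≫ e.hom ≫ biprod.snd = 𝟙 Z)) z
  have hpg : Function.LeftInverse p g := by
    rintro ⟨y, z⟩
    refine Prod.ext ?_ ?_
    · refine (map_add (e.hom ≫ biprod.fst).hom.hom _ _).trans ?_
      exact (congrArg₂ (· + ·) (h1 y) (h3 z)).trans (add_zero _)
    · refine (map_add (e.hom ≫ biprod.snd).hom.hom _ _).trans ?_
      exact (congrArg₂ (· + ·) (h2 y) (h4 z)).trans (zero_add _)
  have h5 := LinearMap.finrank_le_finrank_of_injective hpg.injective
  rw [Module.finrank_prod] at h5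
  have h6 : Module.finrank K Z ≠ 0 := fun h0 =>
    hZ (FGModuleCat.isZero_of_subsingleton (Module.finrank_zero_iff.1 h0))
  omega

variable (K V) in
/-- Gabriel's theorem: the path algebra of a simply laced Dynkin quiver is of finite
representation type. -/
theorem exists_finite_indecomposable :
    ∃ F : Set {M : ModPathAlgebra K V // Indecomposable M}, F.Finite ∧
      ∀ M : {M : ModPathAlgebra K V // Indecomposable M}, ∃ L ∈ F, Nonempty (L.1 ≅ M.1) := by
  have : ∀ i j : V, Fintype (i ⟶ j) := fun i j => Fintype.ofFinite _
  obtain ⟨F, hF, h⟩ := QuiverRep.exists_finite_isIsomorphic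
    (fun M : {M : ModPathAlgebra K V // Indecomposable M} => PathAlgebra.toRep K V M.1)
    fun M => by
      have : Nontrivial M.1 := not_subsingleton_iff_nontrivial.1 fun hs =>
        M.2.1 (FGModuleCat.isZero_of_subsingleton hs)
      exact PathAlgebra.isIndec_toRep fun e he =>
        FGModuleCat.eq_zero_or_eq_id_of_indecomposable M.2 e he
  refine ⟨F, hF, fun M => ?_⟩
  obtain ⟨L, hL, hLM⟩ := h M
  obtain ⟨e⟩ := PathAlgebra.nonempty_linearEquiv_of_isIsomorphic hLM
  exact ⟨L, hL, ⟨LinearEquiv.toFGModuleCatIso e⟩⟩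

end ModPathAlgebra

/-! ### The join formula -/

theorem propositionP {K : Type u} [Field K] {V : Type u} [Fintype V] [Quiver.{u} V]
    [IsSimplyLacedDynkin V] [HasDerivedCategory.{w} (ModPathAlgebra K V)]
    (N : GoodMetric (DerivedCategory.Bounded (ModPathAlgebra K V))) (hN : N.IsAdditive) :
    IsLUB
      (Set.range fun M : {M : ModPathAlgebra K V // Indecomposable M} =>
        N.toLattice ⊓ (GoodMetric.const (triangGenerated (stalkObj M.1))).toLattice)
      N.toLattice := by
  refine ⟨by rintro _ ⟨M, rfl⟩; exact inf_le_left, ?_⟩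
  rintro ⟨D⟩ hD n
  have hD' : ∀ M : {M : ModPathAlgebra K V // Indecomposable M}, ∃ m,
      (N.inter (GoodMetric.const (triangGenerated (stalkObj M.1)))).ball m ≤ D.ball n :=
    fun M => hD ⟨M, rfl⟩ n
  choose m hm using hD'
  obtain ⟨F, hF, hF'⟩ := ModPathAlgebra.exists_finite_indecomposable K V
  -- Finite representation type enters here: a single radius `B` works for all representatives in
  -- `F`, and balls decrease with the radius.
  obtain ⟨B, hB⟩ := (hF.image m).bddAbove
  refine ⟨B, hN.ball_le_of_indecomposable ModPathAlgebra.hasProjectiveDimensionLT_two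
    (fun M => Module.finrank K M) ModPathAlgebra.finrank_lt_of_iso_biprod fun M k hM hk => ?_⟩
  obtain ⟨L, hL, ⟨e⟩⟩ := hF' ⟨M, hM⟩
  -- The bound is known only for the representative `L`; the shift of `M` lies in `⟨L⟩` because `M ≅
  -- L` and `⟨L⟩` is closed under shifts and isomorphisms.
  refine hm L _ ⟨N.ball_antitone (hB ⟨L, hL, rfl⟩) _ hk, ?_⟩
  refine (triangGenerated (stalkObj L.1)).le_shift k _ ?_
  exact (triangGenerated (stalkObj L.1)).prop_of_iso ((stalkFunctor _).mapIso e)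
    (triangGenerated_self _)
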